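/- Let $r\in\{\infty,\omega\}$ ($C^\omega$ meaning real analytic), let $U\subset\mathbb R^2$ be open, let $f:U\to\mathbb R^3$ be a $C^r$-map, and let $p\in U$ be a cuspidal edge or a cuspidal cross cap singular point of $f$, i.e. the germ of $f$ at $p$ is $C^r$ right-left equivalent to the germ at $(0,0)$ of $(u,v)\mapsto(v^2,v^3,u)$, respectively of $(u,v)\mapsto(v^2,uv^3,u)$. Near $p$ let $\nu$ be a $C^r$ unit normal vector field of $f$ and let $\gamma$ be a regular $C^r$-curve with $\gamma(0)=p$ parametrizing the singular set of $f$; with $\hat\gamma=f\circ\gamma$, the limiting normal curvature at $p$ is $\kappa_\nu(p)=\dfrac{\hat\gamma''(0)\cdot\nu(p)}{\hat\gamma'(0)\cdot\hat\gamma'(0)}$. Let $\Pi_0$ be the limiting tangent plane (the plane through $f(p)$ perpendicular to $\nu(p)$), $\Pi_1$ the normal plane (the plane through $f(p)$ perpendicular to the tangent line $f(p)+df_p(\mathbb R^2)$), and $l_2=\Pi_0\cap\Pi_1$ the co-normal line. Let $T\neq\mathrm{id}$ be an isometry of $\mathbb R^3$ fixing $f(p)$ that maps the image of the germ of $f$ at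 $p$ into itself: for every open neighbourhood $U'\subset U$ of $p$ there is an open neighbourhood $V\subset U$ of $p$ with $T(f(V))\subset f(U')$. Then there are a connected open neighbourhood $W\subset U$ of $p$ and a $C^r$-involution $\psi:W\to W$ with $\psi(p)=p$ and $f\circ\psi=T\circ f$ on $W$; the germ of $\psi$ at $p$ is the only germ of a continuous map fixing $p$ with $f\circ\psi=T\circ f$. Moreover, $W$ can be chosen so that the following hold. 1. If $\kappa_\nu(p)\neq0$, then $T$ is the reflection in the normal plane $\Pi_1$. 2. Suppose that $p$ is a cuspidal edge. Then $\psi$ is orientation-reversing on $W$, unless $T$ is the $180^\circ$-rotation about $l_2$; and $\psi$ reverses the orientation of the singular curve, unless $T$ is the reflection in $\Pi_0$. (In particular, by 1, both hold if $\kappa_\nu(p)\ne 0$.) 3. Suppose that $p$ is a cuspidal cross cap. Then $\psi$ is orientation-preserving on $W$, unless $T$ is the reflection in $\Pi_0$ or the $180^\circ$-rotation about $l_2$; and $\psi$ reverses the orientation of the singular curve, unless $T$ is the reflection in $\Pi_0$. (In particular, by 1, both hold if $\kappa_\nu(p)\neq0$.) Moreover, every point $f(q)$ with $q\in W$ such that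 $f(q)=f(q')$ for some $q'\in W\setminus\{q\}$ is fixed by $T$, and it lies in $\Pi_1$ unless $T$ is the reflection in $\Pi_0$. -/

import Mathlib

open Filter Topology
open scoped ContDiff InnerProductSpace

noncomputable section

/-- Euclidean three-space. -/
abbrev E3 : Type := EuclideanSpace ℝ (Fin 3)

/-- The germ of `f` at `p` is `C^r` right-left equivalent to the germ of `g` at `q`: there are
local `C^r`-diffeomorphisms `φ` of the source and `Φ` of the target with `Φ ∘ f = g ∘ φ`
near `p`. -/
def RightLeftEquivAt (r : WithTop ℕ∞) (f : ℝ × ℝ → E3) (p : ℝ × ℝ)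
    (g : ℝ × ℝ → E3) (q : ℝ × ℝ) : Prop :=
  ∃ (φ : OpenPartialHomeomorph (ℝ × ℝ) (ℝ × ℝ)) (Φ : OpenPartialHomeomorph E3 E3),
    p ∈ φ.source ∧ φ p = q ∧ f p ∈ Φ.source ∧ Φ (f p) = g q ∧
    ContDiffOn ℝ r φ φ.source ∧ ContDiffOn ℝ r φ.symm φ.target ∧
    ContDiffOn ℝ r Φ Φ.source ∧ ContDiffOn ℝ r Φ.symm Φ.target ∧
    ∀ᶠ x in 𝓝 p, Φ (f x) = g (φ x)

/-- The standard cuspidal edge `(u, v) ↦ (v², v³, u)`. -/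
def stdCuspidalEdge (x : ℝ × ℝ) : E3 := !₂[x.2 ^ 2, x.2 ^ 3, x.1]

/-- The standard cuspidal cross cap `(u, v) ↦ (v², u v³, u)`. -/
def stdCuspidalCrossCap (x : ℝ × ℝ) : E3 := !₂[x.2 ^ 2, x.1 * x.2 ^ 3, x.1]

/-- `p` is a cuspidal edge singular point of `f`. -/
def IsCuspidalEdge (r : WithTop ℕ∞) (f : ℝ × ℝ → E3) (p : ℝ × ℝ) : Prop :=
  RightLeftEquivAt r f p stdCuspidalEdge (0, 0)

/-- `p` is a cuspidal cross cap singular point of `f`. -/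
def IsCuspidalCrossCap (r : WithTop ℕ∞) (f : ℝ × ℝ → E3) (p : ℝ × ℝ) : Prop :=
  RightLeftEquivAt r f p stdCuspidalCrossCap (0, 0)

/-- The singular set of `f : U → ℝ³`: the points at which `f` is not an immersion. -/
def singularSet (f : ℝ × ℝ → E3) (U : Set (ℝ × ℝ)) : Set (ℝ × ℝ) :=
  {q ∈ U | ¬ Function.Injective (fderiv ℝ f q)}

/-- `ν` is (near `p`) a `C^r` unit normal vector field of `f`. -/
def IsUnitNormalNear (r : WithTop ℕ∞) (f ν : ℝ × ℝ → E3) (p : ℝ × ℝ) : Prop :=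
  ∀ᶠ q in 𝓝 p, ContDiffAt ℝ r ν q ∧ ‖ν q‖ = 1 ∧ ∀ w : ℝ × ℝ, ⟪fderiv ℝ f q w, ν q⟫_ℝ = 0

/-- `γ` is (near `t = 0`) a regular `C^r`-curve with `γ 0 = p` parametrizing the singular set
of `f : U → ℝ³` near `p`. The last condition says that `γ t` is singular for small `t`, and that
`γ` maps each neighbourhood of `0` onto a neighbourhood of `p` in the singular set. -/
def IsSingularCurve (r : WithTop ℕ∞) (f : ℝ × ℝ → E3) (U : Set (ℝ × ℝ)) (p : ℝ × ℝ)
    (γ : ℝ → ℝ × ℝ) : Prop :=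
  γ 0 = p ∧ (∀ᶠ t in 𝓝 (0 : ℝ), ContDiffAt ℝ r γ t) ∧ deriv γ 0 ≠ 0 ∧
    map γ (𝓝 0) = 𝓝[singularSet f U] p

/-- The limiting normal curvature `(γ̂'' · ν) / (γ̂' · γ̂')` at `γ 0`, with `γ̂ = f ∘ γ` for a
parametrization `γ` of the singular curve and a unit normal vector field `ν`. -/
def limitingNormalCurvature (f ν : ℝ × ℝ → E3) (γ : ℝ → ℝ × ℝ) : ℝ :=
  ⟪iteratedDeriv 2 (f ∘ γ) 0, ν (γ 0)⟫_ℝ / ⟪deriv (f ∘ γ) 0, deriv (f ∘ γ) 0⟫_ℝ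

/-- The direction of the tangent line of `f` at a corank one singular point: the image of `df`
(in coordinates with `f_v(p) = 0` it is spanned by `f_u(p)`). -/
abbrev tangentDirection (f : ℝ × ℝ → E3) (p : ℝ × ℝ) : Submodule ℝ E3 :=
  LinearMap.range (fderiv ℝ f p : ℝ × ℝ →ₗ[ℝ] E3)

/-- The limiting tangent plane: the plane through `f p` perpendicular to `ν p`. -/
abbrev limitingTangentPlane (f ν : ℝ × ℝ → E3) (p : ℝ × ℝ) : AffineSubspace ℝ E3 :=
  AffineSubspace.mk' (f p) (Submodule.span ℝ {ν p})ᗮ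

/-- The normal plane: the plane through `f p` perpendicular to the tangent line. -/
abbrev normalPlane (f : ℝ × ℝ → E3) (p : ℝ × ℝ) : AffineSubspace ℝ E3 :=
  AffineSubspace.mk' (f p) (tangentDirection f p)ᗮ

/-- The co-normal line: the line through `f p` that lies in the limiting tangent plane and is
perpendicular to the tangent line. -/
abbrev conormalLine (f ν : ℝ × ℝ → E3) (p : ℝ × ℝ) : AffineSubspace ℝ E3 :=
  AffineSubspace.mk' (f p) ((Submodule.span ℝ {ν p})ᗮ ⊓ (tangentDirection f p)ᗮ)

/-- The orthogonal reflection of `ℝ³` in the affine subspace `A`. For a line `A` this is the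
rotation by `180°` about `A`. -/
abbrev reflectionIn (A : AffineSubspace ℝ E3) [Nonempty A] : E3 ≃ᵢ E3 :=
  (EuclideanGeometry.reflection A).toIsometryEquiv

/-- `T` maps the image of the germ of `f : U → ℝ³` at `p` into itself: for every open
neighbourhood `U' ⊆ U` of `p` there is an open neighbourhood `V ⊆ U` of `p` with
`T (f V) ⊆ f U'`. -/
def PreservesImageGerm (T : E3 ≃ᵢ E3) (f : ℝ × ℝ → E3) (U : Set (ℝ × ℝ)) (p : ℝ × ℝ) : Prop :=
  ∀ U' : Set (ℝ × ℝ), IsOpen U' → p ∈ U' → U' ⊆ U →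
    ∃ V : Set (ℝ × ℝ), IsOpen V ∧ p ∈ V ∧ V ⊆ U ∧ T '' (f '' V) ⊆ f '' U'

/-- `ψ` is a `C^r`-involution of the open set `W`. -/
def IsInvolutionOn (r : WithTop ℕ∞) (ψ : ℝ × ℝ → ℝ × ℝ) (W : Set (ℝ × ℝ)) : Prop :=
  ContDiffOn ℝ r ψ W ∧ Set.MapsTo ψ W W ∧ ∀ q ∈ W, ψ (ψ q) = q

/-- `ψ` preserves the orientation of the plane on the open set `W`. -/
def PreservesOrientationOn (ψ : ℝ × ℝ → ℝ × ℝ) (W : Set (ℝ × ℝ)) : Prop :=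
  ∀ q ∈ W, 0 < (fderiv ℝ ψ q).det

/-- `ψ` reverses the orientation of the plane on the open set `W`. -/
def ReversesOrientationOn (ψ : ℝ × ℝ → ℝ × ℝ) (W : Set (ℝ × ℝ)) : Prop :=
  ∀ q ∈ W, (fderiv ℝ ψ q).det < 0

/-- `ψ` maps the curve `γ` to itself near `γ 0`, fixing `γ 0` and reversing the direction of
`γ`: `ψ ∘ γ = γ ∘ θ` for an orientation-reversing `C^r`-change of parameter `θ` with
`θ 0 = 0`. -/
def ReversesCurve (r : WithTop ℕ∞) (ψ : ℝ × ℝ → ℝ × ℝ) (γ : ℝ → ℝ × ℝ) : Prop :=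
  ∃ θ : ℝ → ℝ, θ 0 = 0 ∧ (∀ᶠ t in 𝓝 (0 : ℝ), ContDiffAt ℝ r θ t) ∧ deriv θ 0 < 0 ∧
    ∀ᶠ t in 𝓝 (0 : ℝ), ψ (γ t) = γ (θ t)

/-- The set of self-intersections of the restriction of `f` to `W`. -/
def selfIntersectionSet (f : ℝ × ℝ → E3) (W : Set (ℝ × ℝ)) : Set (ℝ × ℝ) :=
  {q ∈ W | ∃ q' ∈ W, q' ≠ q ∧ f q' = f q}

end

noncomputable section

/-! In charts both singularities are `g(u, v) = (v², c(u) v³, u)`, with `c = 1` for the cuspidal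
edge and `c = id` for the cross cap. Conjugating `T` by the target chart gives a germ `S` of a
diffeomorphism mapping the image germ of `g` into the image of `g`, hence into `{X₀ ≥ 0, X₁² =
c(X₂)² X₀³}`.

Lifting `S` through `g`. Write `a`, `b`, `U` for the components of `S ∘ g`. The equation of the
image is singular along the axis `v = 0`, and an immersion germ cannot remove this, so `a` and `b`
vanish there (`IsChartSymmetry.axis_zero`). Division by `v` gives `a = v² m`, `b = v³ k` with `k² =
c(U)² m³` and `m(0) > 0` (`exists_factor`, `fderiv_stdVec_zero`). One sign `σ` satisfies `k = σ c(U)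
m√m` on a full neighbourhood (`exists_sign`), so `(U, σ v √m)` is a lift of class `C^r` with
derivative `diag(ε, τ)` at the origin.

Linear algebra. The same computation shows that `dS` at the origin preserves a flag, with diagonal
entries `ε`, `τ²` and `δ`, where `δ = τ³` for the edge and `δ = ε τ³` for the cross cap. Transported
to `ℝ³` this is the linear part of an isometry, hence diagonal in an orthogonal frame
(`exists_isEigenframe`): tangent direction `t` with eigenvalue `ε = ±1`, co-normal direction `e`
with eigenvalue `τ² = 1`, normal `ν` with eigenvalue `δ = ±1`. As `T` is not the identity, `(ε, δ)`
is `(-1, 1)`, `(1, -1)` or `(-1, -1)`: the reflection in `Π₁`, the reflection in `Π₀`, the half-turn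
about `l₂`. The lift acts on the singular curve with derivative `ε`, and its determinant is `ε τ`,
that is `ε δ` for the edge and `δ` for the cross cap.

Remaining points. A continuous germ `χ` fixing `p` with `f ∘ χ = f` is the identity, because `g` has
no double points off `u = 0` (`eventually_eq_id`); this yields the involution and its uniqueness. If
`δ = -1`, the height of the singular curve over `Π₀` is anti-invariant, which a nonzero second
derivative forbids (`not_anti_invariant`). Double points of the cross cap lie over `u = 0`, where
`f` is determined by its `e`-component, which `T` preserves. -/

/-- `F` is of class `C^r` at all points near `x`. -/
def SmoothNear {E F : Type*} [NormedAddCommGroup E] [NormedSpace ℝ E] [NormedAddCommGroup F]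
    [NormedSpace ℝ F] (r : WithTop ℕ∞) (f : E → F) (x : E) : Prop :=
  ∀ᶠ y in 𝓝 x, ContDiffAt ℝ r f y

/-! ### Parametric integrals and division by `v` -/

/-- Induction on `n` by differentiating under the integral sign. The target space varies in the
induction, since the derivative is an integral of the same kind with values in `H →L[ℝ] F`. -/
theorem contDiff_intervalIntegral_nat {H : Type} [NormedAddCommGroup H] [NormedSpace ℝ H]
    [ProperSpace H] (n : ℕ) : ∀ {F : Type} [NormedAddCommGroup F] [NormedSpace ℝ F]
    [CompleteSpace F] (G : ℝ × H → F), ContDiff ℝ n G →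
      ContDiff ℝ n (fun x => ∫ t in (0 : ℝ)..1, G (t, x)) := by
  induction n with
  | zero =>
    intro F _ _ _ G hG
    have hG' : Continuous G := hG.continuous
    rw [Nat.cast_zero, contDiff_zero]
    exact intervalIntegral.continuous_parametric_intervalIntegral_of_continuous'
      (f := fun x t => G (t, x)) (by fun_prop) _ _
  | succ n ih =>
    intro F _ _ _ G hG
    have hGc : Continuous G := hG.continuous
    have hG' : ContDiff ℝ n (fderiv ℝ G) := hG.fderiv_right (by simp)
    let D : ℝ × H → (H →L[ℝ] F) := fun z => (fderiv ℝ G z).comp (ContinuousLinearMap.inr ℝ ℝ H)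
    have hD : ContDiff ℝ n D := hG'.clm_comp contDiff_const
    have hDc : Continuous D := hD.continuous
    have key : ∀ x₀ : H, HasFDerivAt (fun x => ∫ t in (0 : ℝ)..1, G (t, x))
        (∫ t in (0 : ℝ)..1, D (t, x₀)) x₀ := by
      intro x₀
      -- The dominating function is a constant: the partial derivative is bounded on the compact set
      -- `[0, 1] × closedBall x₀ 1`.
      obtain ⟨C, hC⟩ := ((isCompact_Icc (a := (0 : ℝ)) (b := 1)).prod
        (isCompact_closedBall x₀ 1)).exists_bound_of_continuousOn hDc.continuousOn
      refine intervalIntegral.hasFDerivAt_integral_of_dominated_of_fderiv_le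
        (F := fun x t => G (t, x)) (F' := fun x t => D (t, x)) (bound := fun _ => C)
        (Metric.ball_mem_nhds x₀ one_pos) ?_ ?_ ?_ ?_ ?_ ?_
      · exact Eventually.of_forall fun x =>
          (by fun_prop : Continuous fun t => G (t, x)).aestronglyMeasurable
      · exact (by fun_prop : Continuous fun t => G (t, x₀)).intervalIntegrable _ _
      · exact (by fun_prop : Continuous fun t => D (t, x₀)).aestronglyMeasurable
      · refine Eventually.of_forall fun t ht x hx =>
          hC (t, x) ⟨?_, Metric.ball_subset_closedBall hx⟩
        rw [Set.uIoc_of_le zero_le_one] at ht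
        exact ⟨ht.1.le, ht.2⟩
      · exact intervalIntegrable_const
      · refine Eventually.of_forall fun t _ x _ => ?_
        have h1 : HasFDerivAt G (fderiv ℝ G (t, x)) (t, x) :=
          (hG.differentiable (by simp)).differentiableAt.hasFDerivAt
        exact h1.comp x (hasFDerivAt_prodMk_right t x)
    rw [Nat.cast_add, Nat.cast_one, contDiff_succ_iff_fderiv]
    refine ⟨fun x => (key x).differentiableAt, by simp, ?_⟩
    rw [show fderiv ℝ (fun x => ∫ t in (0 : ℝ)..1, G (t, x)) =
      fun x => ∫ t in (0 : ℝ)..1, D (t, x) from funext fun x => (key x).fderiv]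
    exact ih D hD

/-- The linear map `(u, v) ↦ (u, t v)`. -/
def scaleSnd (t : ℝ) : ℝ × ℝ →L[ℝ] ℝ × ℝ :=
  (ContinuousLinearMap.fst ℝ ℝ ℝ).prod (t • ContinuousLinearMap.snd ℝ ℝ ℝ)

theorem scaleSnd_apply (t : ℝ) (x : ℝ × ℝ) : scaleSnd t x = (x.1, t * x.2) := rfl

theorem norm_scaleSnd_le {t : ℝ} (ht : |t| ≤ 1) : ‖scaleSnd t‖ ≤ 1 := by
  refine ContinuousLinearMap.opNorm_le_bound _ zero_le_one fun x => ?_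
  rw [scaleSnd_apply, one_mul, Prod.norm_def, Prod.norm_def]
  refine max_le_max le_rfl ?_
  rw [norm_mul]
  exact mul_le_of_le_one_left (norm_nonneg _) ht

theorem continuous_scaleSnd : Continuous scaleSnd := by
  have h : scaleSnd = fun t =>
      (ContinuousLinearMap.inl ℝ ℝ ℝ).comp (ContinuousLinearMap.fst ℝ ℝ ℝ) +
      t • (ContinuousLinearMap.inr ℝ ℝ ℝ).comp (ContinuousLinearMap.snd ℝ ℝ ℝ) := by
    funext t
    ext <;> simp [scaleSnd_apply]
  rw [h]
  fun_prop

/-- The power series is integrated term by term. For `t` in `[0, 1]` the map `scaleSnd t` has norm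
at most one, so the averaged coefficients are bounded by the original ones and the radius of
convergence does not drop. -/
theorem analyticAt_integral_scaleSnd {F : ℝ × ℝ → ℝ} (hF : AnalyticAt ℝ F 0) :
    AnalyticAt ℝ (fun x => ∫ t in (0 : ℝ)..1, F (scaleSnd t x)) 0 := by
  obtain ⟨p, r, hp⟩ := hF
  let Q : ∀ n, ℝ → (ℝ × ℝ) [×n]→L[ℝ] ℝ := fun n t =>
    (p n).compContinuousLinearMap (fun _ => scaleSnd t)
  have hQc : ∀ n, Continuous (Q n) := fun n => by
    have := (ContinuousMultilinearMap.compContinuousLinearMapContinuousMultilinear ℝ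
      (fun _ : Fin n => ℝ × ℝ) (fun _ : Fin n => ℝ × ℝ) ℝ).cont.comp
      (continuous_pi fun _ : Fin n => continuous_scaleSnd)
    exact this.clm_apply continuous_const
  have hQb : ∀ n, ∀ t ∈ Set.uIoc (0 : ℝ) 1, ‖Q n t‖ ≤ ‖p n‖ := fun n t ht => by
    rw [Set.uIoc_of_le zero_le_one] at ht
    refine ((p n).norm_compContinuousLinearMap_le _).trans ?_
    refine mul_le_of_le_one_right (norm_nonneg _) (Finset.prod_le_one (fun _ _ => norm_nonneg _) ?_)
    exact fun _ _ => norm_scaleSnd_le (abs_le.2 ⟨by linarith [ht.1], ht.2⟩)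
  let q : FormalMultilinearSeries ℝ (ℝ × ℝ) ℝ := fun n => ∫ t in (0 : ℝ)..1, Q n t
  have hqp : ∀ n, ‖q n‖ ≤ ‖p n‖ := fun n => by
    simpa using intervalIntegral.norm_integral_le_of_norm_le_const (hQb n)
  refine ⟨q, r, hp.r_le.trans (FormalMultilinearSeries.radius_le_of_le fun n => hqp n),
    hp.r_pos, fun {y} hy => ?_⟩
  have hqy : ∀ n, (q n fun _ => y) = ∫ t in (0 : ℝ)..1, p n fun _ => scaleSnd t y := fun n => by
    have := (ContinuousMultilinearMap.apply ℝ (fun _ : Fin n => ℝ × ℝ) ℝ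
      (fun _ => y)).intervalIntegral_comp_comm
        ((hQc n).intervalIntegrable (μ := MeasureTheory.volume) 0 1)
    exact this.symm
  simp only [hqy, zero_add]
  have hsum : Summable fun n => ‖p n‖ * ‖y‖ ^ n := by
    have := p.summable_norm_mul_pow (r := ‖y‖₊)
      (lt_of_lt_of_le (by simpa [enorm_eq_nnnorm] using hy) hp.r_le)
    simpa using this
  have hy' : ∀ t ∈ Set.uIoc (0 : ℝ) 1, ‖scaleSnd t y‖ ≤ ‖y‖ := fun t ht => by
    rw [Set.uIoc_of_le zero_le_one] at ht
    exact ((scaleSnd t).le_opNorm y).trans (mul_le_of_le_one_left (norm_nonneg _)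
      (norm_scaleSnd_le (abs_le.2 ⟨by linarith [ht.1], ht.2⟩)))
  refine intervalIntegral.hasSum_integral_of_dominated_convergence
    (fun n _ => ‖p n‖ * ‖y‖ ^ n) ?_ ?_ ?_ ?_ ?_
  · intro n
    refine Continuous.aestronglyMeasurable ?_
    exact (p n).cont.comp (continuous_pi fun _ => continuous_scaleSnd.clm_apply continuous_const)
  · refine fun n => Eventually.of_forall fun t ht => ?_
    refine ((p n).le_opNorm _).trans ?_
    simp only [Finset.prod_const, Finset.card_univ, Fintype.card_fin]
    gcongr
    exact hy' t ht
  · exact Eventually.of_forall fun t _ => hsum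
  · exact intervalIntegrable_const
  · refine Eventually.of_forall fun t ht => ?_
    have h1 : scaleSnd t y ∈ Metric.eball (0 : ℝ × ℝ) r := by
      simp only [Metric.mem_eball, edist_zero_right] at hy ⊢
      refine lt_of_le_of_lt ?_ hy
      exact enorm_le_iff_norm_le.2 (hy' t ht)
    simpa using hp.hasSum h1

/-- A cutoff by a bump function; it supplies the global smoothness needed for smooth dependence of
the integral on parameters. -/
theorem exists_contDiff_eventuallyEq {F : ℝ × ℝ → ℝ} (hF : SmoothNear ∞ F 0) :
    ∃ G : ℝ × ℝ → ℝ, ContDiff ℝ ∞ G ∧ ∀ᶠ x in 𝓝 0, G x = F x := by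
  obtain ⟨ε, hε, hball⟩ := Metric.eventually_nhds_iff_ball.1 hF
  let χ : ContDiffBump (0 : ℝ × ℝ) := ⟨ε / 4, ε / 2, by positivity, by linarith⟩
  refine ⟨fun x => χ x * F x, ?_, ?_⟩
  · rw [contDiff_iff_contDiffAt]
    intro x
    by_cases hx : x ∈ Metric.ball (0 : ℝ × ℝ) ε
    · exact χ.contDiffAt.mul (hball x hx)
    · have : (fun x => χ x * F x) =ᶠ[𝓝 x] fun _ => 0 := by
        have hx' : x ∈ (Metric.closedBall (0 : ℝ × ℝ) (ε / 2))ᶜ := fun h =>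
          hx (Metric.closedBall_subset_ball (by linarith) h)
        filter_upwards [Metric.isClosed_closedBall.isOpen_compl.mem_nhds hx'] with y hy
        rw [χ.zero_of_le_dist, zero_mul]
        rw [Set.mem_compl_iff, Metric.mem_closedBall, not_le] at hy
        exact hy.le
      exact contDiffAt_const.congr_of_eventuallyEq this
  · filter_upwards [χ.eventuallyEq_one] with x hx
    simp [hx]

/-- Hadamard's formula: the fundamental theorem of calculus along the segment `t ↦ (u, t v)`. -/
theorem integral_deriv_scaleSnd {F : ℝ × ℝ → ℝ} {x : ℝ × ℝ}
    (hF : ∀ t ∈ Set.Icc (0 : ℝ) 1, ContDiffAt ℝ 1 F (scaleSnd t x)) :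
    x.2 * ∫ t in (0 : ℝ)..1, fderiv ℝ F (scaleSnd t x) (0, 1) = F x - F (x.1, 0) := by
  have h1 : ∀ t ∈ Set.uIcc (0 : ℝ) 1, HasDerivAt (fun t => F (scaleSnd t x))
      (x.2 * fderiv ℝ F (scaleSnd t x) (0, 1)) t := by
    intro t ht
    rw [Set.uIcc_of_le zero_le_one] at ht
    have h2 := ((hF t ht).differentiableAt one_ne_zero).hasFDerivAt
    have h3 : HasDerivAt (fun t => scaleSnd t x) ((0 : ℝ), x.2) t := by
      simp only [scaleSnd_apply]
      exact (hasDerivAt_const t x.1).prodMk (by simpa using (hasDerivAt_id t).mul_const x.2)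
    have h4 := h2.comp_hasDerivAt t h3
    have h5 : ((0 : ℝ), x.2) = x.2 • ((0 : ℝ), (1 : ℝ)) := by simp
    rwa [h5, map_smul, smul_eq_mul] at h4
  rw [← intervalIntegral.integral_const_mul,
    intervalIntegral.integral_eq_sub_of_hasDerivAt h1 ?_]
  · simp [scaleSnd_apply]
  · refine ContinuousOn.intervalIntegrable fun t ht => ContinuousAt.continuousWithinAt ?_
    rw [Set.uIcc_of_le zero_le_one] at ht
    have h2 : ContinuousAt (fderiv ℝ F) (scaleSnd t x) :=
      ((hF t ht).fderiv_right (m := 0) (by simp)).continuousAt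
    have h3 : ContinuousAt (fun t => scaleSnd t x) t :=
      (continuous_scaleSnd.clm_apply continuous_const).continuousAt
    exact continuousAt_const.mul
      ((ContinuousAt.comp (f := fun t => scaleSnd t x) h2 h3).clm_apply continuousAt_const)

/-- A function of class `C^r` near the origin that vanishes on the axis `v = 0` is divisible
by `v`. -/
theorem exists_eq_snd_mul {r : WithTop ℕ∞} (hr : r = ∞ ∨ r = ω) {F : ℝ × ℝ → ℝ}
    (hF : SmoothNear r F 0) (h0 : ∀ᶠ u in 𝓝 (0 : ℝ), F (u, 0) = 0) :
    ∃ G : ℝ × ℝ → ℝ, SmoothNear r G 0 ∧ ∀ᶠ x in 𝓝 0, F x = x.2 * G x := by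
  have h0' : ∀ᶠ x in 𝓝 (0 : ℝ × ℝ), F (x.1, 0) = 0 :=
    (continuous_fst.tendsto' (0 : ℝ × ℝ) 0 rfl).eventually h0
  -- In both classes the quotient is the average of `∂F/∂v` over the segment. In the smooth case `F`
  -- is first replaced by a global extension; a cutoff would destroy analyticity, so the analytic
  -- case uses the averaged power series instead.
  rcases hr with rfl | rfl
  · obtain ⟨F', hF', he⟩ := exists_contDiff_eventuallyEq hF
    have he0 : ∀ᶠ x in 𝓝 (0 : ℝ × ℝ), F' (x.1, 0) = F (x.1, 0) :=
      ((by fun_prop : Continuous fun x : ℝ × ℝ => (x.1, (0 : ℝ))).tendsto' 0 0 rfl).eventually he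
    refine ⟨fun x => ∫ t in (0 : ℝ)..1, fderiv ℝ F' (scaleSnd t x) (0, 1), ?_, ?_⟩
    · refine Eventually.of_forall fun y => ContDiff.contDiffAt ?_
      rw [contDiff_infty]
      intro n
      refine contDiff_intervalIntegral_nat n (fun z : ℝ × (ℝ × ℝ) =>
        fderiv ℝ F' (scaleSnd z.1 z.2) (0, 1)) ?_
      have h1 : ContDiff ℝ n (fderiv ℝ F') := hF'.fderiv_right (by exact_mod_cast le_top)
      simp only [scaleSnd_apply]
      exact (h1.comp (by fun_prop)).clm_apply contDiff_const
    · filter_upwards [he, he0, h0'] with x h1 h2 h3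
      rw [integral_deriv_scaleSnd fun t _ => (hF'.of_le (by exact_mod_cast le_top)).contDiffAt,
        h1, h2, h3, sub_zero]
  · refine ⟨fun x => ∫ t in (0 : ℝ)..1, fderiv ℝ F (scaleSnd t x) (0, 1), ?_, ?_⟩
    · have h1 : AnalyticAt ℝ (fun x => fderiv ℝ F x (0, 1)) 0 := by
        have := hF.self_of_nhds.analyticAt.fderiv
        exact (ContinuousLinearMap.analyticAt
          (ContinuousLinearMap.apply ℝ ℝ ((0 : ℝ), (1 : ℝ))) _).comp this
      exact (analyticAt_integral_scaleSnd h1).eventually_analyticAt.mono fun y hy =>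
        hy.contDiffAt
    · obtain ⟨ε, hε, hball⟩ := Metric.eventually_nhds_iff_ball.1 hF
      filter_upwards [h0', Metric.ball_mem_nhds _ hε] with x h3 hx
      rw [integral_deriv_scaleSnd, h3, sub_zero]
      intro t ht
      refine (hball _ ?_).of_le (by simp)
      rw [mem_ball_zero_iff] at hx ⊢
      exact lt_of_le_of_lt (((scaleSnd t).le_opNorm x).trans (mul_le_of_le_one_left (norm_nonneg _)
        (norm_scaleSnd_le (abs_le.2 ⟨by linarith [ht.1], ht.2⟩)))) hx

/-! ### Germs of class `C^r` and difference quotients -/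

section SmoothNear

variable {E F G : Type*} [NormedAddCommGroup E] [NormedSpace ℝ E] [NormedAddCommGroup F]
  [NormedSpace ℝ F] [NormedAddCommGroup G] [NormedSpace ℝ G] {r : WithTop ℕ∞}

theorem SmoothNear.contDiffAt {f : E → F} {x : E} (hf : SmoothNear r f x) : ContDiffAt ℝ r f x :=
  hf.self_of_nhds

theorem ContDiff.smoothNear {f : E → F} (hf : ContDiff ℝ r f) (x : E) : SmoothNear r f x :=
  Eventually.of_forall fun _ => hf.contDiffAt

theorem ContDiffOn.smoothNear {f : E → F} {s : Set E} (hf : ContDiffOn ℝ r f s) (hs : IsOpen s)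
    {x : E} (hx : x ∈ s) : SmoothNear r f x :=
  (hs.eventually_mem hx).mono fun _ hy => hf.contDiffAt (hs.mem_nhds hy)

theorem SmoothNear.comp {g : F → G} {f : E → F} {x : E} (hg : SmoothNear r g (f x))
    (hf : SmoothNear r f x) : SmoothNear r (fun y => g (f y)) x := by
  filter_upwards [hf.contDiffAt.continuousAt.eventually hg, hf] with y h1 h2
  exact h1.comp y h2

theorem SmoothNear.comp_of_eq {g : F → G} {f : E → F} {x : E} {y : F} (hg : SmoothNear r g y)
    (hf : SmoothNear r f x) (h : f x = y) : SmoothNear r (fun y => g (f y)) x := by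
  subst h; exact hg.comp hf

theorem SmoothNear.congr {f g : E → F} {x : E} (hf : SmoothNear r f x) (h : g =ᶠ[𝓝 x] f) :
    SmoothNear r g x := by
  filter_upwards [hf, h.eventuallyEq_nhds] with y h1 h2
  exact h1.congr_of_eventuallyEq h2

/-- A strictly differentiable function has the expected difference quotients along
differences `P - Q = s • w`. -/
theorem HasStrictFDerivAt.tendsto_quotient {α : Type*} {l : Filter α} {h : E → F} {h' : E →L[ℝ] F}
    {X : E} (hh : HasStrictFDerivAt h h' X) {P Q : α → E} {s : α → ℝ} {w : α → E} {w₀ : E}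
    (hP : Tendsto P l (𝓝 X)) (hQ : Tendsto Q l (𝓝 X)) (hw : Tendsto w l (𝓝 w₀))
    (hPQ : ∀ᶠ i in l, P i - Q i = s i • w i) (hs : ∀ᶠ i in l, s i ≠ 0) :
    Tendsto (fun i => (s i)⁻¹ • (h (P i) - h (Q i))) l (𝓝 (h' w₀)) := by
  have h1 := hh.isLittleO.comp_tendsto (hP.prodMk_nhds hQ)
  have h2 : (fun i => P i - Q i) =O[l] s := by
    have : (fun i => s i • w i) =O[l] fun i => s i * 1 := by
      simpa using (Asymptotics.isBigO_refl s l).smul (hw.isBigO_one ℝ)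
    simpa using this.congr' (hPQ.mono fun i hi => hi.symm) EventuallyEq.rfl
  have h3 := (h1.trans_isBigO h2).tendsto_inv_smul_nhds_zero
  have h4 : Tendsto (fun i => h' (w i)) l (𝓝 (h' w₀)) := (h'.continuous.tendsto w₀).comp hw
  have h5 := h3.add h4
  rw [zero_add] at h5
  refine h5.congr' ?_
  filter_upwards [hPQ, hs] with i hi hsi
  simp only [Function.comp_apply]
  rw [hi, map_smul, smul_sub, smul_smul, inv_mul_cancel₀ hsi, one_smul, sub_add_cancel]

end SmoothNear

/-! ### The common normal form of the two singularities -/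

/-- The standard basis vectors of `ℝ³`. -/
abbrev stdVec (i : Fin 3) : E3 := EuclideanSpace.single i 1

/-- The map `(u, v) ↦ (v², c(u) v³, u)`. -/
def foldedMap (c : ℝ → ℝ) (x : ℝ × ℝ) : E3 := !₂[x.2 ^ 2, c x.1 * x.2 ^ 3, x.1]

/-- The coefficient functions of the two normal forms. -/
def IsFoldCoeff (c : ℝ → ℝ) : Prop := c = (fun _ => 1) ∨ c = id

theorem stdCuspidalEdge_eq : stdCuspidalEdge = foldedMap fun _ => 1 := by
  funext x; simp [stdCuspidalEdge, foldedMap]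

theorem stdCuspidalCrossCap_eq : stdCuspidalCrossCap = foldedMap id := rfl

section foldedMap

variable {c : ℝ → ℝ}

@[simp] theorem foldedMap_apply_zero (c : ℝ → ℝ) (x : ℝ × ℝ) : foldedMap c x 0 = x.2 ^ 2 := rfl
@[simp] theorem foldedMap_apply_one (c : ℝ → ℝ) (x : ℝ × ℝ) :
    foldedMap c x 1 = c x.1 * x.2 ^ 3 := rfl
@[simp] theorem foldedMap_apply_two (c : ℝ → ℝ) (x : ℝ × ℝ) : foldedMap c x 2 = x.1 := rfl

theorem E3.ext' {x y : E3} (h0 : x 0 = y 0) (h1 : x 1 = y 1) (h2 : x 2 = y 2) : x = y := by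
  ext i; fin_cases i <;> assumption

theorem foldedMap_eq (c : ℝ → ℝ) (x : ℝ × ℝ) : foldedMap c x =
    x.2 ^ 2 • stdVec 0 + (c x.1 * x.2 ^ 3) • stdVec 1 + x.1 • stdVec 2 := by
  apply E3.ext' <;> simp

theorem foldedMap_axis (c : ℝ → ℝ) (u : ℝ) : foldedMap c (u, 0) = u • stdVec 2 := by
  simp [foldedMap_eq]

theorem foldedMap_zero (c : ℝ → ℝ) : foldedMap c 0 = 0 := by
  rw [show (0 : ℝ × ℝ) = (0, 0) from rfl, foldedMap_axis, zero_smul]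

theorem IsFoldCoeff.contDiff (hc : IsFoldCoeff c) {r : WithTop ℕ∞} : ContDiff ℝ r c := by
  rcases hc with rfl | rfl
  · exact contDiff_const
  · exact contDiff_id

theorem IsFoldCoeff.ne_zero (hc : IsFoldCoeff c) {u : ℝ} (hu : u ≠ 0) : c u ≠ 0 := by
  rcases hc with rfl | rfl
  · exact one_ne_zero
  · exact hu

theorem contDiff_foldedMap (hc : IsFoldCoeff c) {r : WithTop ℕ∞} : ContDiff ℝ r (foldedMap c) := by
  have h : foldedMap c = fun x : ℝ × ℝ =>
    x.2 ^ 2 • stdVec 0 + (c x.1 * x.2 ^ 3) • stdVec 1 + x.1 • stdVec 2 := funext (foldedMap_eq c)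
  have hc' : ContDiff ℝ r c := hc.contDiff
  rw [h]
  fun_prop

theorem continuous_foldedMap (hc : IsFoldCoeff c) : Continuous (foldedMap c) :=
  (contDiff_foldedMap hc (r := 0)).continuous

/-- A smooth function vanishing on the image of `foldedMap c` has vanishing derivative at
each image of a point of the axis at which `c` does not vanish. -/
theorem fderiv_eq_zero_of_comp_foldedMap (hc : IsFoldCoeff c) {u : ℝ} (hu : c u ≠ 0) {h : E3 → ℝ}
    {h' : E3 →L[ℝ] ℝ} (hh : HasStrictFDerivAt h h' (foldedMap c (u, 0)))
    (h0 : ∀ᶠ x in 𝓝 (u, (0 : ℝ)), h (foldedMap c x) = 0) : h' = 0 := by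
  have hg := continuous_foldedMap hc
  have t1 : Tendsto (fun v : ℝ => (u, v)) (𝓝[≠] 0) (𝓝 (u, 0)) :=
    ((by fun_prop : Continuous fun v : ℝ => (u, v)).tendsto' 0 _ rfl).mono_left nhdsWithin_le_nhds
  have t2 : Tendsto (fun v : ℝ => (u, -v)) (𝓝[≠] 0) (𝓝 (u, 0)) :=
    ((by fun_prop : Continuous fun v : ℝ => (u, -v)).tendsto' 0 _ (by simp)).mono_left
      nhdsWithin_le_nhds
  have t3 : Tendsto (fun v : ℝ => (u + v, (0 : ℝ))) (𝓝[≠] 0) (𝓝 (u, 0)) :=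
    ((by fun_prop : Continuous fun v : ℝ => (u + v, (0 : ℝ))).tendsto' 0 _ (by simp)).mono_left
      nhdsWithin_le_nhds
  have gt := hg.tendsto (u, (0 : ℝ))
  have ne : ∀ᶠ v : ℝ in 𝓝[≠] 0, v ≠ 0 := eventually_mem_nhdsWithin
  -- The two sheets over `(u, ±v)` differ by exactly `2 c(u) v³` times the second basis vector. Both
  -- points move, which is why strict differentiability is assumed.
  have e1 : h' (stdVec 1) = 0 := by
    have := hh.tendsto_quotient (gt.comp t1) (gt.comp t2) (tendsto_const_nhds (x := stdVec 1))
      (s := fun v => 2 * c u * v ^ 3)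
      (Eventually.of_forall fun v => by apply E3.ext' <;> simp; ring)
      (ne.mono fun v hv => by positivity)
    refine tendsto_nhds_unique (this.congr' ?_) tendsto_const_nhds
    filter_upwards [t1.eventually h0, t2.eventually h0] with v h1 h2
    simp [h1, h2]
  have e2 : h' (stdVec 2) = 0 := by
    have := hh.tendsto_quotient (gt.comp t3) tendsto_const_nhds (tendsto_const_nhds (x := stdVec 2))
      (s := fun v => v)
      (Eventually.of_forall fun v => by apply E3.ext' <;> simp) ne
    refine tendsto_nhds_unique (this.congr' ?_) tendsto_const_nhds
    filter_upwards [t3.eventually h0] with v h1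
    simp [h1, h0.self_of_nhds]
  -- Along `u` constant the increment is `v²` times `stdVec 0 + (c u * v) • stdVec 1`, whose
  -- direction tends to `stdVec 0`.
  have e0 : h' (stdVec 0) = 0 := by
    have hw : Tendsto (fun v : ℝ => stdVec 0 + (c u * v) • stdVec 1) (𝓝[≠] 0) (𝓝 (stdVec 0)) :=
      ((by fun_prop : Continuous fun v : ℝ => stdVec 0 + (c u * v) • stdVec 1).tendsto' 0 _
        (by simp)).mono_left nhdsWithin_le_nhds
    have := hh.tendsto_quotient (gt.comp t1) tendsto_const_nhds hw (s := fun v => v ^ 2)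
      (Eventually.of_forall fun v => by apply E3.ext' <;> simp; ring)
      (ne.mono fun v hv => by positivity)
    refine tendsto_nhds_unique (this.congr' ?_) tendsto_const_nhds
    filter_upwards [t1.eventually h0] with v h1
    simp [h1, h0.self_of_nhds]
  ext x
  have : x = x 0 • stdVec 0 + x 1 • stdVec 1 + x 2 • stdVec 2 := by apply E3.ext' <;> simp
  rw [this]
  simp [e0, e1, e2]

end foldedMap

/-! ### Symmetries of the normal form preserve the singular axis -/

/-- `S` is a germ of a `C^r`-immersion fixing the origin and mapping the image germ of
`foldedMap c` into the image of `foldedMap c`. -/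
structure IsChartSymmetry (r : WithTop ℕ∞) (c : ℝ → ℝ) (S : E3 → E3) : Prop where
  smooth : SmoothNear r S 0
  map_zero : S 0 = 0
  injective : ∀ᶠ X in 𝓝 (0 : E3), Function.Injective (fderiv ℝ S X)
  image : ∀ᶠ x in 𝓝 (0 : ℝ × ℝ), ∃ y, foldedMap c y = S (foldedMap c x)

namespace IsChartSymmetry

variable {r : WithTop ℕ∞} {c : ℝ → ℝ} {S : E3 → E3}

theorem tendsto_foldedMap (hc : IsFoldCoeff c) :
    Tendsto (foldedMap c) (𝓝 0) (𝓝 0) :=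
  (continuous_foldedMap hc).tendsto' _ _ (foldedMap_zero c)

theorem smooth_comp (hS : IsChartSymmetry r c S) (hc : IsFoldCoeff c) (i : Fin 3) :
    SmoothNear r (fun x => S (foldedMap c x) i) 0 := by
  have h1 : SmoothNear r (fun x => S (foldedMap c x)) 0 :=
    hS.smooth.comp_of_eq ((contDiff_foldedMap hc).smoothNear 0) (foldedMap_zero c)
  exact ((EuclideanSpace.proj i : E3 →L[ℝ] ℝ).contDiff.smoothNear _).comp h1

theorem hasStrictFDerivAt (hS : IsChartSymmetry r c S) (hr : r ≠ 0) :
    HasStrictFDerivAt S (fderiv ℝ S 0) 0 :=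
  hS.smooth.contDiffAt.hasStrictFDerivAt hr

theorem hasStrictFDerivAt_apply (hS : IsChartSymmetry r c S) (hr : r ≠ 0) (i : Fin 3) :
    HasStrictFDerivAt (fun X => S X i)
      ((EuclideanSpace.proj i : E3 →L[ℝ] ℝ).comp (fderiv ℝ S 0)) 0 :=
  (EuclideanSpace.proj i : E3 →L[ℝ] ℝ).hasStrictFDerivAt.comp 0 (hS.hasStrictFDerivAt hr)

/-- All later uses of `image` pass through this equation and inequality. -/
theorem equations (hS : IsChartSymmetry r c S) : ∀ᶠ x in 𝓝 (0 : ℝ × ℝ),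
    0 ≤ S (foldedMap c x) 0 ∧
    S (foldedMap c x) 1 ^ 2 = c (S (foldedMap c x) 2) ^ 2 * S (foldedMap c x) 0 ^ 3 := by
  filter_upwards [hS.image] with x ⟨y, hy⟩
  rw [← hy]
  simp only [foldedMap_apply_zero, foldedMap_apply_one, foldedMap_apply_two]
  exact ⟨by positivity, by ring⟩

theorem tendsto_axis {a : ℝ} : Tendsto (fun u : ℝ => (u, (0 : ℝ))) (𝓝 a) (𝓝 (a, 0)) :=
  (by fun_prop : Continuous fun u : ℝ => (u, (0 : ℝ))).tendsto' _ _ rfl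

theorem hasDerivAt_axis (hS : IsChartSymmetry r c S) (hr : r ≠ 0) (i : Fin 3) :
    HasDerivAt (fun u : ℝ => S (foldedMap c (u, 0)) i) (fderiv ℝ S 0 (stdVec 2) i) 0 := by
  have h1 : HasDerivAt (fun u : ℝ => foldedMap c (u, 0)) (stdVec 2) 0 := by
    simp only [foldedMap_axis]
    simpa using (hasDerivAt_id (0 : ℝ)).smul_const (stdVec 2)
  exact (hS.hasStrictFDerivAt_apply hr i).hasFDerivAt.comp_hasDerivAt_of_eq 0 h1
    (foldedMap_zero c).symm

/-- Along the axis the first component of `S` is nonnegative and vanishes at `0`, so its derivative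
is zero by minimality. The equation then forces the second component to have zero derivative too,
and injectivity of the derivative leaves a nonzero multiple of the axis direction. -/
theorem fderiv_axis (hS : IsChartSymmetry r c S) (hc : IsFoldCoeff c) (hr : r ≠ 0) :
    ∃ ε : ℝ, ε ≠ 0 ∧ fderiv ℝ S 0 (stdVec 2) = ε • stdVec 2 := by
  have ha := hS.hasDerivAt_axis hr 0
  have hb := hS.hasDerivAt_axis hr 1
  have hU := hS.hasDerivAt_axis hr 2
  have heq := tendsto_axis.eventually hS.equations
  have hz : ∀ i, S (foldedMap c ((0 : ℝ), (0 : ℝ))) i = 0 := fun i => by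
    rw [foldedMap_axis, zero_smul, hS.map_zero]; rfl
  have h0 : fderiv ℝ S 0 (stdVec 2) 0 = 0 := by
    refine IsLocalMin.hasDerivAt_eq_zero ?_ ha
    filter_upwards [heq] with u hu
    rw [hz]
    exact hu.1
  have h1 : fderiv ℝ S 0 (stdVec 2) 1 = 0 := by
    rw [h0] at ha
    have ha' := hasDerivAt_iff_tendsto_slope_zero.1 ha
    have hb' := hasDerivAt_iff_tendsto_slope_zero.1 hb
    simp only [zero_add, hz, sub_zero, smul_eq_mul] at ha' hb'
    have tU : Tendsto (fun u : ℝ => c (S (foldedMap c (u, 0)) 2)) (𝓝[≠] 0) (𝓝 (c 0)) :=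
      ((hc.contDiff (r := 0)).continuous.tendsto 0).comp
        (((hz 2) ▸ hU.continuousAt.tendsto).mono_left nhdsWithin_le_nhds)
    have ta : Tendsto (fun u : ℝ => S (foldedMap c (u, 0)) 0) (𝓝[≠] 0) (𝓝 0) :=
      ((hz 0) ▸ ha.continuousAt.tendsto).mono_left nhdsWithin_le_nhds
    -- With `a`, `b`, `U` the components along the axis, `(b/u)² = c(U)² (a/u)² a`, and the right
    -- side tends to `0`.
    have h2 := ((tU.pow 2).mul (ha'.pow 2)).mul ta
    have h3 := tendsto_nhds_unique ((hb'.pow 2).congr' ?_) h2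
    · simpa using h3
    · filter_upwards [heq.filter_mono nhdsWithin_le_nhds] with u hu
      rw [mul_pow, hu.2]; ring
  refine ⟨fderiv ℝ S 0 (stdVec 2) 2, fun h2 => ?_, by apply E3.ext' <;> simp [h0, h1]⟩
  have h3 : fderiv ℝ S 0 (stdVec 2) = fderiv ℝ S 0 0 := by
    rw [_root_.map_zero]
    exact E3.ext' h0 h1 h2
  have := hS.injective.self_of_nhds h3
  simpa using congrArg (fun X : E3 => X 2) this

/-- `S` maps singular points of the normal form to singular points. -/
theorem axis_zero (hS : IsChartSymmetry r c S) (hc : IsFoldCoeff c) (hr : r ≠ 0) :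
    ∀ᶠ u in 𝓝 (0 : ℝ), S (foldedMap c (u, 0)) 0 = 0 ∧ S (foldedMap c (u, 0)) 1 = 0 := by
  obtain ⟨ε, hε, hε'⟩ := hS.fderiv_axis hc hr
  have hU := hS.hasDerivAt_axis hr 2
  have hz : ∀ i, S (foldedMap c ((0 : ℝ), (0 : ℝ))) i = 0 := fun i => by
    rw [foldedMap_axis, zero_smul, hS.map_zero]; rfl
  have hUne : ∀ᶠ u in 𝓝[≠] (0 : ℝ), S (foldedMap c (u, 0)) 2 ≠ 0 :=
    hU.eventually_ne (by rw [hε']; simpa using hε)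
  have heq := tendsto_axis.eventually hS.equations
  have hsm : ∀ᶠ u in 𝓝 (0 : ℝ), ContDiffAt ℝ r S (foldedMap c (u, 0)) ∧
      Function.Injective (fderiv ℝ S (foldedMap c (u, 0))) :=
    ((tendsto_foldedMap hc).comp tendsto_axis).eventually (hS.smooth.and hS.injective)
  have heq2 := tendsto_axis.eventually (eventually_eventually_nhds.2 hS.equations)
  filter_upwards [heq, heq2, hsm, eventually_nhdsWithin_iff.1 hUne] with u h1 h2 h3 h4
  suffices h : S (foldedMap c (u, 0)) 0 = 0 by
    refine ⟨h, ?_⟩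
    have := h1.2
    rw [h] at this
    simpa using this
  by_contra hne
  -- The origin is fixed by `S`, so `u ≠ 0`; this makes `c u` nonzero also for the cross cap.
  have hu : u ≠ 0 := fun h => hne (by rw [h]; exact hz 0)
  have hU0 := hc.ne_zero (h4 hu)
  have hb : S (foldedMap c (u, 0)) 1 ≠ 0 := by
    intro hb
    have := h1.2
    rw [hb, zero_pow two_ne_zero] at this
    exact mul_ne_zero (pow_ne_zero 2 hU0) (pow_ne_zero 3 hne) this.symm
  -- `H` vanishes on the image of the normal form, hence so does `H ∘ S` near the singular point
  -- considered, where its derivative must be zero. As `S` is an immersion, the derivative of `H`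
  -- vanishes at `P`, contrary to `∂H/∂X₁ = 2 P₁ ≠ 0`.
  let H : E3 → ℝ := fun X => X 1 ^ 2 - c (X 2) ^ 2 * X 0 ^ 3
  have hH : ContDiff ℝ 1 H := by
    have hc' : ContDiff ℝ 1 c := hc.contDiff
    have hp : ∀ i : Fin 3, ContDiff ℝ 1 fun X : E3 => X i := fun i =>
      (EuclideanSpace.proj i : E3 →L[ℝ] ℝ).contDiff
    exact ((hp 1).pow 2).sub (((hc'.comp (hp 2)).pow 2).mul ((hp 0).pow 3))
  set P := S (foldedMap c (u, 0)) with hP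
  have hHs := hH.contDiffAt.hasStrictFDerivAt one_ne_zero (x := P)
  have hcomp := hHs.comp (foldedMap c (u, 0)) (h3.1.hasStrictFDerivAt hr)
  have hzero := fderiv_eq_zero_of_comp_foldedMap hc (hc.ne_zero hu) hcomp (by
    filter_upwards [h2] with x hx
    simp only [H, hx.2, sub_self])
  obtain ⟨w, hw⟩ := (LinearMap.injective_iff_surjective (f :=
    (fderiv ℝ S (foldedMap c (u, 0)) : E3 →ₗ[ℝ] E3))).1 h3.2 (stdVec 1)
  have hw' : fderiv ℝ S (foldedMap c (u, 0)) w = stdVec 1 := hw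
  have h5 : fderiv ℝ H P (stdVec 1) = 0 := by
    rw [← hw']
    exact DFunLike.congr_fun hzero w
  have h6 : HasDerivAt (fun t : ℝ => H (P + t • stdVec 1)) (2 * P 1) 0 := by
    have : (fun t : ℝ => H (P + t • stdVec 1)) =
        fun t => (P 1 + t) ^ 2 - c (P 2) ^ 2 * P 0 ^ 3 := by
      funext t; simp [H]
    rw [this]
    have := (((hasDerivAt_id (0 : ℝ)).const_add (P 1)).pow 2).sub_const (c (P 2) ^ 2 * P 0 ^ 3)
    simpa using this
  have h7 : HasDerivAt (fun t : ℝ => H (P + t • stdVec 1)) (fderiv ℝ H P (stdVec 1)) 0 := by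
    have h8 : HasDerivAt (fun t : ℝ => P + t • stdVec 1) (stdVec 1) 0 := by
      simpa using ((hasDerivAt_id (0 : ℝ)).smul_const (stdVec 1)).const_add P
    exact hHs.hasFDerivAt.comp_hasDerivAt_of_eq 0 h8 (by simp)
  have := h6.unique h7
  rw [h5] at this
  exact hb (by simpa using this)

end IsChartSymmetry

/-! ### Density arguments and factorization of the lifted components -/

theorem eventually_eq_of_frequently {X : Type*} [TopologicalSpace X] {f g : X → ℝ} {D : X → Prop}
    {x₀ : X} (hf : ∀ᶠ x in 𝓝 x₀, ContinuousAt f x) (hg : ∀ᶠ x in 𝓝 x₀, ContinuousAt g x)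
    (hD : ∀ᶠ x in 𝓝 x₀, ∃ᶠ y in 𝓝 x, D y) (h : ∀ᶠ x in 𝓝 x₀, D x → f x = g x) :
    ∀ᶠ x in 𝓝 x₀, f x = g x := by
  filter_upwards [hf, hg, hD, eventually_eventually_nhds.2 h] with x h1 h2 h3 h4
  by_contra hne
  have h5 : ∀ᶠ y in 𝓝 x, f y ≠ g y := by
    filter_upwards [(h1.sub h2).eventually_ne (sub_ne_zero.2 hne)] with y hy
    exact sub_ne_zero.1 hy
  obtain ⟨y, hy, hy1, hy2⟩ := (h3.and_eventually (h4.and h5)).exists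
  exact hy2 (hy1 hy)

theorem frequently_snd_ne_zero (x : ℝ × ℝ) : ∃ᶠ y in 𝓝 x, y.2 ≠ 0 := by
  have h : Tendsto (fun t : ℝ => (x.1, x.2 + t)) (𝓝[≠] 0) (𝓝 x) :=
    ((by fun_prop : Continuous fun t : ℝ => (x.1, x.2 + t)).tendsto' 0 _ (by simp)).mono_left
      nhdsWithin_le_nhds
  refine h.frequently (Eventually.frequently ?_)
  by_cases hx : x.2 = 0
  · filter_upwards [eventually_mem_nhdsWithin] with t ht
    simpa [hx] using ht
  · have : ∀ᶠ t in 𝓝 (0 : ℝ), x.2 + t ≠ 0 :=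
      (by fun_prop : Continuous fun t : ℝ => x.2 + t).continuousAt.eventually_ne (by simpa using hx)
    exact this.filter_mono nhdsWithin_le_nhds

theorem eventually_eq_of_snd_ne_zero {f g : ℝ × ℝ → ℝ} {x₀ : ℝ × ℝ}
    (hf : ∀ᶠ x in 𝓝 x₀, ContinuousAt f x) (hg : ∀ᶠ x in 𝓝 x₀, ContinuousAt g x)
    (h : ∀ᶠ x in 𝓝 x₀, x.2 ≠ 0 → f x = g x) : ∀ᶠ x in 𝓝 x₀, f x = g x :=
  eventually_eq_of_frequently hf hg (Eventually.of_forall frequently_snd_ne_zero) h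

/-- Near `x₀` the derivative of `g` in the direction `w` stays nonzero, so the zero set of `g` has
no interior there; `f` vanishes off it and is continuous. -/
theorem eventually_eq_zero_of_mul_eq_zero {E : Type*} [NormedAddCommGroup E] [NormedSpace ℝ E]
    {f g : E → ℝ} {x₀ : E} (hf : ∀ᶠ x in 𝓝 x₀, ContinuousAt f x) (hg : ContDiffAt ℝ 1 g x₀)
    {w : E} (hw : fderiv ℝ g x₀ w ≠ 0) (h : ∀ᶠ x in 𝓝 x₀, f x * g x = 0) :
    ∀ᶠ x in 𝓝 x₀, f x = 0 := by
  have hc : ContinuousAt (fun x => fderiv ℝ g x w) x₀ :=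
    (hg.fderiv_right (m := 0) (by simp)).continuousAt.clm_apply continuousAt_const
  refine eventually_eq_of_frequently (g := fun _ => 0) (D := fun x => g x ≠ 0) hf
    (Eventually.of_forall fun _ => continuousAt_const) ?_ ?_
  · filter_upwards [hc.eventually_ne hw] with x hx hcon
    apply hx
    have : g =ᶠ[𝓝 x] fun _ => 0 := by
      filter_upwards [hcon] with y hy
      simpa using hy
    simp [this.fderiv_eq]
  · filter_upwards [h] with x hx hgx
    exact (mul_eq_zero.1 hx).resolve_right hgx

theorem SmoothNear.eventually_continuousAt {E F : Type*} [NormedAddCommGroup E] [NormedSpace ℝ E]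
    [NormedAddCommGroup F] [NormedSpace ℝ F] {r : WithTop ℕ∞} {f : E → F} {x : E}
    (hf : SmoothNear r f x) : ∀ᶠ y in 𝓝 x, ContinuousAt f y :=
  hf.mono fun _ hy => hy.continuousAt

/-- A function of class `C^r` vanishing to second order along `v = 0` is divisible by `v²`. -/
theorem exists_eq_snd_sq_mul {r : WithTop ℕ∞} (hr : r = ∞ ∨ r = ω) {F : ℝ × ℝ → ℝ}
    (hF : SmoothNear r F 0) (h0 : ∀ᶠ u in 𝓝 (0 : ℝ), F (u, 0) = 0)
    (h1 : ∀ᶠ u in 𝓝 (0 : ℝ), HasDerivAt (fun v => F (u, v)) 0 0) :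
    ∃ G : ℝ × ℝ → ℝ, SmoothNear r G 0 ∧ ∀ᶠ x in 𝓝 0, F x = x.2 ^ 2 * G x := by
  obtain ⟨G, hG, hFG⟩ := exists_eq_snd_mul hr hF h0
  -- On the axis the quotient `G` is the limit of `F(u, v)/v`, that is the vanishing derivative of
  -- `F` in `v`; so `v` can be divided out again.
  have hG0 : ∀ᶠ u in 𝓝 (0 : ℝ), G (u, 0) = 0 := by
    have t := IsChartSymmetry.tendsto_axis (a := 0)
    filter_upwards [h0, h1, t.eventually (eventually_eventually_nhds.2 hFG),
      t.eventually hG.eventually_continuousAt] with u hu0 hu1 hu2 hu3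
    have t1 : Tendsto (fun v : ℝ => (u, v)) (𝓝[≠] 0) (𝓝 (u, 0)) :=
      ((by fun_prop : Continuous fun v : ℝ => (u, v)).tendsto' 0 _ rfl).mono_left nhdsWithin_le_nhds
    have h2 := hasDerivAt_iff_tendsto_slope_zero.1 hu1
    refine tendsto_nhds_unique (hu3.tendsto.comp t1) (h2.congr' ?_)
    filter_upwards [t1.eventually hu2, eventually_mem_nhdsWithin] with v hv hv0
    have hv0' : v ≠ 0 := hv0
    simp only [zero_add, hu0, hv, sub_zero, smul_eq_mul, Function.comp_apply]
    field_simp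
  obtain ⟨G', hG', hGG'⟩ := exists_eq_snd_mul hr hG hG0
  refine ⟨G', hG', ?_⟩
  filter_upwards [hFG, hGG'] with x h2 h3
  rw [h2, h3]; ring

theorem hasDerivAt_foldedMap_snd {c : ℝ → ℝ} (u : ℝ) :
    HasDerivAt (fun v : ℝ => foldedMap c (u, v)) 0 0 := by
  have h : (fun v : ℝ => foldedMap c (u, v)) = fun v : ℝ =>
    v ^ 2 • stdVec 0 + (c u * v ^ 3) • stdVec 1 + u • stdVec 2 := funext fun v => foldedMap_eq c _
  rw [h]
  have h1 := (hasDerivAt_pow 2 (0 : ℝ)).smul_const (stdVec 0)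
  have h2 := ((hasDerivAt_pow 3 (0 : ℝ)).const_mul (c u)).smul_const (stdVec 1)
  simpa using (h1.add h2).add_const (u • stdVec 2)

theorem hasFDerivAt_foldedMap_zero {c : ℝ → ℝ} (hc : IsFoldCoeff c) :
    HasFDerivAt (foldedMap c) ((ContinuousLinearMap.fst ℝ ℝ ℝ).smulRight (stdVec 2)) 0 := by
  have h1 : HasFDerivAt (foldedMap c) (fderiv ℝ (foldedMap c) 0) 0 :=
    ((contDiff_foldedMap hc (r := 1)).differentiable one_ne_zero).differentiableAt.hasFDerivAt
  have h2 : fderiv ℝ (foldedMap c) 0 (1, 0) = stdVec 2 := by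
    have h3 : HasDerivAt (fun u : ℝ => foldedMap c (u, 0)) (stdVec 2) 0 := by
      simp only [foldedMap_axis]
      simpa using (hasDerivAt_id (0 : ℝ)).smul_const (stdVec 2)
    exact (h1.comp_hasDerivAt_of_eq (0 : ℝ) ((hasDerivAt_id (0 : ℝ)).prodMk
      (hasDerivAt_const (0 : ℝ) (0 : ℝ))) rfl).unique h3
  have h4 : fderiv ℝ (foldedMap c) 0 (0, 1) = 0 :=
    (h1.comp_hasDerivAt_of_eq (0 : ℝ) ((hasDerivAt_const (0 : ℝ) (0 : ℝ)).prodMk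
      (hasDerivAt_id (0 : ℝ))) rfl).unique (hasDerivAt_foldedMap_snd 0)
  convert! h1 using 1
  ext x
  · simp [h2]
  · simp [h4]

namespace IsChartSymmetry

variable {r : WithTop ℕ∞} {c : ℝ → ℝ} {S : E3 → E3}

theorem hasDerivAt_snd (hS : IsChartSymmetry r c S) (hc : IsFoldCoeff c) (hr : r ≠ 0) (i : Fin 3) :
    ∀ᶠ u in 𝓝 (0 : ℝ), HasDerivAt (fun v => S (foldedMap c (u, v)) i) 0 0 := by
  filter_upwards [((tendsto_foldedMap hc).comp tendsto_axis).eventually hS.smooth] with u hu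
  have h1 : HasFDerivAt (fun X => S X i) ((EuclideanSpace.proj i : E3 →L[ℝ] ℝ).comp
      (fderiv ℝ S (foldedMap c (u, 0)))) (foldedMap c (u, 0)) :=
    (EuclideanSpace.proj i : E3 →L[ℝ] ℝ).hasFDerivAt.comp _ (hu.differentiableAt hr).hasFDerivAt
  have h2 := h1.comp_hasDerivAt_of_eq (0 : ℝ) (hasDerivAt_foldedMap_snd u) rfl
  rw [_root_.map_zero] at h2
  exact h2

theorem eventually_continuousAt_coeff (hS : IsChartSymmetry r c S) (hc : IsFoldCoeff c) :
    ∀ᶠ x in 𝓝 (0 : ℝ × ℝ), ContinuousAt (fun x => c (S (foldedMap c x) 2)) x := by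
  filter_upwards [(hS.smooth_comp hc 2).eventually_continuousAt] with x hx
  exact ((hc.contDiff (r := 0)).continuous.continuousAt).comp hx

/-- Both components vanish to second order along the axis, so they are `v² m` and `v² n`. Cancelling
`v⁴` in the equation of the image gives `n² = v² c(U)² m³`, so `n` vanishes on the axis and one more
factor `v` splits off. Each cancellation is done off the axis and extended by continuity. -/
theorem exists_factor (hS : IsChartSymmetry r c S) (hc : IsFoldCoeff c) (hr : r = ∞ ∨ r = ω) :
    ∃ m k : ℝ × ℝ → ℝ, SmoothNear r m 0 ∧ SmoothNear r k 0 ∧ ∀ᶠ x in 𝓝 (0 : ℝ × ℝ),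
      S (foldedMap c x) 0 = x.2 ^ 2 * m x ∧ S (foldedMap c x) 1 = x.2 ^ 3 * k x ∧
      k x ^ 2 = c (S (foldedMap c x) 2) ^ 2 * m x ^ 3 := by
  have hr0 : r ≠ 0 := by rcases hr with rfl | rfl <;> simp
  have hax := hS.axis_zero hc hr0
  obtain ⟨m, hm, ham⟩ := exists_eq_snd_sq_mul hr (hS.smooth_comp hc 0) (hax.mono fun _ h => h.1)
    (hS.hasDerivAt_snd hc hr0 0)
  obtain ⟨n, hn, hbn⟩ := exists_eq_snd_sq_mul hr (hS.smooth_comp hc 1) (hax.mono fun _ h => h.2)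
    (hS.hasDerivAt_snd hc hr0 1)
  have hcc := hS.eventually_continuousAt_coeff hc
  have hn2 : ∀ᶠ x in 𝓝 (0 : ℝ × ℝ),
      n x ^ 2 = x.2 ^ 2 * (c (S (foldedMap c x) 2) ^ 2 * m x ^ 3) := by
    refine eventually_eq_of_snd_ne_zero ?_ ?_ ?_
    · exact hn.eventually_continuousAt.mono fun x hx => hx.pow 2
    · filter_upwards [hcc, hm.eventually_continuousAt] with x h1 h2
      exact (continuousAt_snd.pow 2).mul ((h1.pow 2).mul (h2.pow 3))
    · filter_upwards [hS.equations, ham, hbn] with x h1 h2 h3 hx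
      have h4 := h1.2
      rw [h2, h3] at h4
      have : x.2 ^ 4 ≠ 0 := pow_ne_zero _ hx
      apply mul_left_cancel₀ this
      linear_combination h4
  obtain ⟨k, hk, hnk⟩ := exists_eq_snd_mul hr hn (by
    filter_upwards [tendsto_axis.eventually hn2] with u hu
    simpa using hu)
  refine ⟨m, k, hm, hk, ?_⟩
  have hk2 : ∀ᶠ x in 𝓝 (0 : ℝ × ℝ), k x ^ 2 = c (S (foldedMap c x) 2) ^ 2 * m x ^ 3 := by
    refine eventually_eq_of_snd_ne_zero ?_ ?_ ?_
    · exact hk.eventually_continuousAt.mono fun x hx => hx.pow 2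
    · filter_upwards [hcc, hm.eventually_continuousAt] with x h1 h2
      exact (h1.pow 2).mul (h2.pow 3)
    · filter_upwards [hn2, hnk] with x h1 h2 hx
      rw [h2] at h1
      apply mul_left_cancel₀ (pow_ne_zero 2 hx)
      linear_combination h1
  filter_upwards [ham, hbn, hnk, hk2] with x h1 h2 h3 h4
  exact ⟨h1, by rw [h2, h3]; ring, h4⟩

/-- The curve `v ↦ foldedMap c (0, v)` leaves the origin like `v² • stdVec 0`, so quotients by `v²`
compute this column of the derivative. The inequality on the image gives `m 0 ≥ 0`; if it were zero,
the columns of `stdVec 0` and `stdVec 2` would be parallel. -/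
theorem fderiv_stdVec_zero (hS : IsChartSymmetry r c S) (hc : IsFoldCoeff c) (hr : r ≠ 0)
    {m k : ℝ × ℝ → ℝ} (hm : ContinuousAt m 0) (hk : ContinuousAt k 0)
    (h : ∀ᶠ x in 𝓝 (0 : ℝ × ℝ), S (foldedMap c x) 0 = x.2 ^ 2 * m x ∧
      S (foldedMap c x) 1 = x.2 ^ 3 * k x) :
    fderiv ℝ S 0 (stdVec 0) 0 = m 0 ∧ fderiv ℝ S 0 (stdVec 0) 1 = 0 ∧ 0 < m 0 := by
  have t1 : Tendsto (fun v : ℝ => ((0 : ℝ), v)) (𝓝[≠] 0) (𝓝 0) :=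
    ((by fun_prop : Continuous fun v : ℝ => ((0 : ℝ), v)).tendsto' 0 _ rfl).mono_left
      nhdsWithin_le_nhds
  have hw : Tendsto (fun v : ℝ => stdVec 0 + (c 0 * v) • stdVec 1) (𝓝[≠] 0) (𝓝 (stdVec 0)) :=
    ((by fun_prop : Continuous fun v : ℝ => stdVec 0 + (c 0 * v) • stdVec 1).tendsto' 0 _
      (by simp)).mono_left nhdsWithin_le_nhds
  have ne : ∀ᶠ v : ℝ in 𝓝[≠] 0, v ≠ 0 := eventually_mem_nhdsWithin
  have key : ∀ i, Tendsto (fun v : ℝ => (v ^ 2)⁻¹ • (S (foldedMap c (0, v)) i - S 0 i)) (𝓝[≠] 0)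
      (𝓝 (fderiv ℝ S 0 (stdVec 0) i)) := fun i =>
    (hS.hasStrictFDerivAt_apply hr i).tendsto_quotient ((tendsto_foldedMap hc).comp t1)
      tendsto_const_nhds hw (s := fun v => v ^ 2)
      (Eventually.of_forall fun v => by apply E3.ext' <;> simp; ring)
      (ne.mono fun v hv => by positivity)
  have h0 : fderiv ℝ S 0 (stdVec 0) 0 = m 0 := by
    refine tendsto_nhds_unique (key 0) ((hm.tendsto.comp t1).congr' ?_)
    filter_upwards [t1.eventually h, ne] with v hv hv0
    rw [hv.1, hS.map_zero]
    simp [hv0]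
  have h1 : fderiv ℝ S 0 (stdVec 0) 1 = 0 := by
    have t2 : Tendsto (fun v : ℝ => v * k (0, v)) (𝓝[≠] 0) (𝓝 (0 * k 0)) :=
      (tendsto_nhdsWithin_of_tendsto_nhds tendsto_id).mul (hk.tendsto.comp t1)
    rw [zero_mul] at t2
    refine tendsto_nhds_unique (key 1) (t2.congr' ?_)
    filter_upwards [t1.eventually h, ne] with v hv hv0
    rw [hv.2, hS.map_zero]
    simp
    field_simp
  refine ⟨h0, h1, lt_of_le_of_ne ?_ fun hm0 => ?_⟩
  · rw [← h0]
    refine ge_of_tendsto (key 0) ?_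
    filter_upwards [t1.eventually hS.equations] with v hv
    rw [hS.map_zero]
    simpa using mul_nonneg (inv_nonneg.2 (sq_nonneg v)) hv.1
  · obtain ⟨ε, hε, he⟩ := hS.fderiv_axis hc hr
    have h3 : fderiv ℝ S 0 (ε • stdVec 0 - (fderiv ℝ S 0 (stdVec 0) 2) • stdVec 2) =
        fderiv ℝ S 0 0 := by
      rw [map_sub, map_smul, map_smul, he, _root_.map_zero]
      apply E3.ext' <;> simp [h0, h1, ← hm0]
      ring
    have := congrArg (fun X : E3 => X 0) (hS.injective.self_of_nhds h3)
    simp at this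
    exact hε this

theorem hasFDerivAt_comp_foldedMap_two (hS : IsChartSymmetry r c S) (hc : IsFoldCoeff c)
    (hr : r ≠ 0)
    {ε : ℝ} (he : fderiv ℝ S 0 (stdVec 2) = ε • stdVec 2) :
    HasFDerivAt (fun x => S (foldedMap c x) 2) (ε • ContinuousLinearMap.fst ℝ ℝ ℝ) 0 := by
  have h1 := (hS.hasStrictFDerivAt_apply hr 2).hasFDerivAt
  rw [← foldedMap_zero c] at h1
  have := h1.comp (0 : ℝ × ℝ) (hasFDerivAt_foldedMap_zero hc)
  convert! this using 1
  ext <;> simp [foldedMap_zero, he]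

/-- The product of `k - c(U) M` and `k + c(U) M` is zero, and one factor has to vanish identically.
For the edge one of them is nonzero at the origin. For the cross cap values at the origin do not
decide, as `c(U)` vanishes there; but the factors differ by `2 U M`, whose `u`-derivative is `2 ε M
0 ≠ 0`, so one factor has nonzero derivative and a zero set without interior. -/
theorem exists_sign (hS : IsChartSymmetry r c S) (hc : IsFoldCoeff c) (hr : r = ∞ ∨ r = ω)
    {M k : ℝ × ℝ → ℝ} (hM : SmoothNear r M 0) (hk : SmoothNear r k 0) (hM0 : M 0 ≠ 0)
    (h : ∀ᶠ x in 𝓝 (0 : ℝ × ℝ), k x ^ 2 = c (S (foldedMap c x) 2) ^ 2 * M x ^ 2) :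
    ∃ σ : ℝ, σ ^ 2 = 1 ∧ ∀ᶠ x in 𝓝 (0 : ℝ × ℝ), k x = σ * c (S (foldedMap c x) 2) * M x := by
  have hr0 : r ≠ 0 := by rcases hr with rfl | rfl <;> simp
  have hr1 : 1 ≤ r := by rcases hr with rfl | rfl <;> simp
  let cU : ℝ × ℝ → ℝ := fun x => c (S (foldedMap c x) 2)
  have hcU : SmoothNear r cU 0 := (hc.contDiff.smoothNear _).comp (hS.smooth_comp hc 2)
  have hP : SmoothNear r (fun x => k x - cU x * M x) 0 := by
    filter_upwards [hcU, hk, hM] with x h1 h2 h3 using h2.sub (h1.mul h3)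
  have hQ : SmoothNear r (fun x => k x + cU x * M x) 0 := by
    filter_upwards [hcU, hk, hM] with x h1 h2 h3 using h2.add (h1.mul h3)
  have hPQ : ∀ᶠ x in 𝓝 (0 : ℝ × ℝ), (k x - cU x * M x) * (k x + cU x * M x) = 0 := by
    filter_upwards [h] with x hx
    linear_combination hx
  have hQP : ∀ᶠ x in 𝓝 (0 : ℝ × ℝ), (k x + cU x * M x) * (k x - cU x * M x) = 0 := by
    filter_upwards [h] with x hx
    linear_combination hx
  suffices hs : (∀ᶠ x in 𝓝 (0 : ℝ × ℝ), k x - cU x * M x = 0) ∨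
      ∀ᶠ x in 𝓝 (0 : ℝ × ℝ), k x + cU x * M x = 0 by
    rcases hs with hs | hs
    · exact ⟨1, by norm_num, hs.mono fun x hx => by linear_combination hx⟩
    · exact ⟨-1, by norm_num, hs.mono fun x hx => by linear_combination hx⟩
  rcases hc with rfl | rfl
  · have hne : k 0 - M 0 ≠ 0 ∨ k 0 + M 0 ≠ 0 := by
      by_contra! hcon
      exact hM0 (by linarith)
    rcases hne with hne | hne
    · right
      have : ∀ᶠ x in 𝓝 (0 : ℝ × ℝ), k x - cU x * M x ≠ 0 :=
        hP.contDiffAt.continuousAt.eventually_ne (by simpa [cU] using hne)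
      filter_upwards [this, hPQ] with x h1 h2 using (mul_eq_zero.1 h2).resolve_left h1
    · left
      have : ∀ᶠ x in 𝓝 (0 : ℝ × ℝ), k x + cU x * M x ≠ 0 :=
        hQ.contDiffAt.continuousAt.eventually_ne (by simpa [cU] using hne)
      filter_upwards [this, hPQ] with x h1 h2 using (mul_eq_zero.1 h2).resolve_right h1
  · obtain ⟨ε, hε, he⟩ := hS.fderiv_axis (.inr rfl) hr0
    have hU := hS.hasFDerivAt_comp_foldedMap_two (.inr rfl) hr0 he
    have hU0 : S (foldedMap id 0) 2 = 0 := by rw [foldedMap_zero, hS.map_zero]; rfl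
    have hUM := hU.mul (hM.contDiffAt.differentiableAt hr0).hasFDerivAt
    have hk' := (hk.contDiffAt.differentiableAt hr0).hasFDerivAt
    have hP' := (hk'.sub hUM).fderiv
    have hQ' := (hk'.add hUM).fderiv
    have hne : fderiv ℝ (fun x => k x - cU x * M x) 0 (1, 0) ≠ 0 ∨
        fderiv ℝ (fun x => k x + cU x * M x) 0 (1, 0) ≠ 0 := by
      by_contra! hcon
      have e1 := hcon.1
      have e2 := hcon.2
      rw [show (fun x => k x - cU x * M x) =
        k - (fun x => S (foldedMap id x) 2) * M from rfl, hP'] at e1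
      rw [show (fun x => k x + cU x * M x) =
        k + (fun x => S (foldedMap id x) 2) * M from rfl, hQ'] at e2
      simp [hU0] at e1 e2
      have : M 0 * ε = 0 := by linarith
      exact mul_ne_zero hM0 hε this
    rcases hne with hne | hne
    · exact .inr (eventually_eq_zero_of_mul_eq_zero hQ.eventually_continuousAt
        (hP.contDiffAt.of_le hr1) hne hQP)
    · exact .inl (eventually_eq_zero_of_mul_eq_zero hP.eventually_continuousAt
        (hQ.contDiffAt.of_le hr1) hne hPQ)

end IsChartSymmetry

/-! ### The lift and its derivative -/

namespace IsChartSymmetry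

variable {r : WithTop ℕ∞} {c : ℝ → ℝ} {S : E3 → E3}

/-- The transversal part of the derivative of a chart symmetry, computed along the two
diagonals `v = u` and `v = -u`. -/
theorem fderiv_stdVec_one (hS : IsChartSymmetry r c S) (hc : IsFoldCoeff c) (hr : r ≠ 0)
    {k M : ℝ × ℝ → ℝ} (hM : ContinuousAt M 0) {σ ε : ℝ}
    (he : fderiv ℝ S 0 (stdVec 2) = ε • stdVec 2)
    (hb : ∀ᶠ x in 𝓝 (0 : ℝ × ℝ), S (foldedMap c x) 1 = x.2 ^ 3 * k x)
    (hk : ∀ᶠ x in 𝓝 (0 : ℝ × ℝ), k x = σ * c (S (foldedMap c x) 2) * M x) :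
    (c = (fun _ => 1) → fderiv ℝ S 0 (stdVec 1) 1 = σ * M 0) ∧
    (c = id → fderiv ℝ S 0 (stdVec 1) 1 = σ * ε * M 0) := by
  have ne : ∀ᶠ v : ℝ in 𝓝[≠] 0, v ≠ 0 := eventually_mem_nhdsWithin
  have t1 : Tendsto (fun v : ℝ => (v, v)) (𝓝[≠] 0) (𝓝 0) :=
    ((by fun_prop : Continuous fun v : ℝ => (v, v)).tendsto' 0 _ rfl).mono_left
      nhdsWithin_le_nhds
  have t2 : Tendsto (fun v : ℝ => (v, -v)) (𝓝[≠] 0) (𝓝 0) :=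
    ((by fun_prop : Continuous fun v : ℝ => (v, -v)).tendsto' 0 _ (by simp)).mono_left
      nhdsWithin_le_nhds
  -- The diagonals replace the line `u = 0`, on which the two sheets of the cross cap coincide; here
  -- they differ by `2 c(v) v³` with `c(v) ≠ 0`.
  have key := (hS.hasStrictFDerivAt_apply hr 1).tendsto_quotient
    ((tendsto_foldedMap hc).comp t1) ((tendsto_foldedMap hc).comp t2)
    (tendsto_const_nhds (x := stdVec 1)) (s := fun v => 2 * c v * v ^ 3)
    (Eventually.of_forall fun v => by apply E3.ext' <;> simp; ring)
    (ne.mono fun v hv => by have := hc.ne_zero hv; positivity)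
  have key' : Tendsto (fun v : ℝ => σ / 2 *
      (c (S (foldedMap c (v, v)) 2) / c v * M (v, v) +
        c (S (foldedMap c (v, -v)) 2) / c v * M (v, -v))) (𝓝[≠] 0)
      (𝓝 (fderiv ℝ S 0 (stdVec 1) 1)) := by
    refine key.congr' ?_
    filter_upwards [ne, t1.eventually hb, t2.eventually hb, t1.eventually hk, t2.eventually hk]
      with v hv h1 h2 h3 h4
    have hcv := hc.ne_zero hv
    simp only [Function.comp_apply, h1, h2, h3, h4, smul_eq_mul]
    field_simp
    ring
  have tM1 := hM.tendsto.comp t1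
  have tM2 := hM.tendsto.comp t2
  refine ⟨?_, ?_⟩
  · rintro rfl
    have h1 := (tM1.add tM2).const_mul (σ / 2)
    refine tendsto_nhds_unique key' ?_
    rw [show σ * M 0 = σ / 2 * (M 0 + M 0) by ring]
    simpa using h1
  · rintro rfl
    have hU := hS.hasFDerivAt_comp_foldedMap_two hc hr he
    have hU0 : S (foldedMap id 0) 2 = 0 := by rw [foldedMap_zero, hS.map_zero]; rfl
    have d1 : HasDerivAt (fun v : ℝ => S (foldedMap id (v, v)) 2) ε 0 := by
      have := hU.comp_hasDerivAt_of_eq (0 : ℝ) ((hasDerivAt_id (0 : ℝ)).prodMk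
        (hasDerivAt_id (0 : ℝ))) rfl
      simp at this; exact this
    have d2 : HasDerivAt (fun v : ℝ => S (foldedMap id (v, -v)) 2) ε 0 := by
      have := hU.comp_hasDerivAt_of_eq (0 : ℝ) ((hasDerivAt_id (0 : ℝ)).prodMk
        (hasDerivAt_neg (0 : ℝ))) (by simp; rfl)
      simp at this; exact this
    have q1 := hasDerivAt_iff_tendsto_slope_zero.1 d1
    have q2 := hasDerivAt_iff_tendsto_slope_zero.1 d2
    have z : ((0 : ℝ), (0 : ℝ)) = 0 := rfl
    simp only [zero_add, neg_zero, z, hU0, sub_zero, smul_eq_mul] at q1 q2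
    have h1 := ((q1.mul tM1).add (q2.mul tM2)).const_mul (σ / 2)
    refine tendsto_nhds_unique key' ?_
    rw [show σ * ε * M 0 = σ / 2 * (ε * M 0 + ε * M 0) by ring]
    refine h1.congr fun v => ?_
    simp only [id, Function.comp_apply]
    ring

/-- A chart symmetry lifts to a `C^r`-map of the source. -/
theorem exists_lift (hS : IsChartSymmetry r c S) (hc : IsFoldCoeff c) (hr : r = ∞ ∨ r = ω) :
    ∃ (ψ : ℝ × ℝ → ℝ × ℝ) (ε τ : ℝ), SmoothNear r ψ 0 ∧ ψ 0 = 0 ∧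
      (∀ᶠ x in 𝓝 0, foldedMap c (ψ x) = S (foldedMap c x)) ∧ (∀ u, (ψ (u, 0)).2 = 0) ∧
      ε ≠ 0 ∧ τ ≠ 0 ∧
      HasFDerivAt ψ ((ε • ContinuousLinearMap.fst ℝ ℝ ℝ).prod
        (τ • ContinuousLinearMap.snd ℝ ℝ ℝ)) 0 ∧
      fderiv ℝ S 0 (stdVec 2) = ε • stdVec 2 ∧
      fderiv ℝ S 0 (stdVec 0) 0 = τ ^ 2 ∧ fderiv ℝ S 0 (stdVec 0) 1 = 0 ∧
      (c = (fun _ => 1) → fderiv ℝ S 0 (stdVec 1) 1 = τ ^ 3) ∧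
      (c = id → fderiv ℝ S 0 (stdVec 1) 1 = ε * τ ^ 3) := by
  have hr0 : r ≠ 0 := by rcases hr with rfl | rfl <;> simp
  obtain ⟨m, k, hm, hk, hmk⟩ := hS.exists_factor hc hr
  obtain ⟨hS0, hS1, hm0⟩ := hS.fderiv_stdVec_zero hc hr0 hm.contDiffAt.continuousAt
    hk.contDiffAt.continuousAt (hmk.mono fun x hx => ⟨hx.1, hx.2.1⟩)
  have hmpos : ∀ᶠ x in 𝓝 (0 : ℝ × ℝ), 0 < m x :=
    hm.contDiffAt.continuousAt.eventually (lt_mem_nhds hm0)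
  have hsq : SmoothNear r (fun x => √(m x)) 0 := by
    filter_upwards [hm, hmpos] with x h1 h2 using h1.sqrt h2.ne'
  have hM : SmoothNear r (fun x => m x * √(m x)) 0 := by
    filter_upwards [hm, hsq] with x h1 h2 using h1.mul h2
  obtain ⟨σ, hσ, hkσ⟩ := hS.exists_sign hc hr hM hk
    (mul_ne_zero hm0.ne' (Real.sqrt_pos.2 hm0).ne') (by
      filter_upwards [hmk, hmpos] with x h1 h2
      rw [h1.2.2, mul_pow, Real.sq_sqrt h2.le]; ring)
  obtain ⟨ε, hε, he⟩ := hS.fderiv_axis hc hr0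
  have hδ := hS.fderiv_stdVec_one hc hr0 hM.contDiffAt.continuousAt he
    (hmk.mono fun x hx => hx.2.1) hkσ
  have hs0 := Real.sq_sqrt hm0.le
  have hσ0 : σ ≠ 0 := fun h => by simp [h] at hσ
  have hτ3 : (σ * √(m 0)) ^ 3 = σ * (m 0 * √(m 0)) := by
    linear_combination (σ * √(m 0) ^ 3) * hσ + σ * √(m 0) * hs0
  have hU := hS.hasFDerivAt_comp_foldedMap_two hc hr0 he
  -- The third component dictates the first coordinate. The second one, `y = σ v √m`, satisfies `y²
  -- = v² m` and `c(U) y³ = v³ k` because `σ² = 1`.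
  refine ⟨fun x => (S (foldedMap c x) 2, x.2 * (σ * √(m x))), ε, σ * √(m 0), ?_, ?_, ?_, ?_, hε,
    mul_ne_zero hσ0 (Real.sqrt_pos.2 hm0).ne', ?_, he, ?_, hS1, ?_, ?_⟩
  · filter_upwards [hS.smooth_comp hc 2, hsq] with x h1 h2
    exact h1.prodMk (contDiffAt_snd.mul (contDiffAt_const.mul h2))
  · simp [foldedMap_zero, hS.map_zero]
  · filter_upwards [hmk, hmpos, hkσ] with x h1 h2 h3
    have h4 := Real.sq_sqrt h2.le
    apply E3.ext'
    · simp only [foldedMap_apply_zero]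
      rw [h1.1]
      linear_combination (x.2 ^ 2 * √(m x) ^ 2) * hσ + x.2 ^ 2 * h4
    · simp only [foldedMap_apply_one]
      rw [h1.2.1, h3]
      linear_combination (c (S (foldedMap c x) 2) * x.2 ^ 3 * σ * √(m x) ^ 3) * hσ +
        (c (S (foldedMap c x) 2) * x.2 ^ 3 * σ * √(m x)) * h4
    · simp
  · intro u; simp
  · refine hU.prodMk ?_
    have h1 := (hasFDerivAt_snd (𝕜 := ℝ) (p := (0 : ℝ × ℝ))).mul
      ((hsq.contDiffAt.differentiableAt hr0).hasFDerivAt.const_mul σ)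
    convert! h1 using 1
    simp
  · rw [hS0]; linear_combination (-√(m 0) ^ 2) * hσ - hs0
  · intro h; rw [hδ.1 h, hτ3]
  · intro h; rw [hδ.2 h, hτ3]; ring

end IsChartSymmetry

/-! ### Eigenframes of linear isometries and the three possible symmetries -/

/-- An orthogonal frame of `ℝ³` made of eigenvectors `t`, `e`, `n` of the linear isometry `L`
with eigenvalues `ε = ±1`, `1` and `δ = ±1`. -/
structure IsEigenframe (L : E3 ≃ₗᵢ[ℝ] E3) (t e n : E3) (ε δ : ℝ) : Prop where
  t_ne : t ≠ 0
  e_ne : e ≠ 0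
  n_ne : n ≠ 0
  inner_e_t : ⟪e, t⟫_ℝ = 0
  inner_n_t : ⟪n, t⟫_ℝ = 0
  inner_n_e : ⟪n, e⟫_ℝ = 0
  map_t : L t = ε • t
  map_e : L e = e
  map_n : L n = δ • n
  sq_ε : ε ^ 2 = 1
  sq_δ : δ ^ 2 = 1
  span : ∀ v, ∃ a b c : ℝ, v = a • t + b • e + c • n

theorem sq_eq_one_of_map_eq_smul (L : E3 ≃ₗᵢ[ℝ] E3) {v : E3} (hv : v ≠ 0) {a : ℝ}
    (h : L v = a • v) : a ^ 2 = 1 := by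
  have h1 := L.norm_map v
  rw [h, norm_smul, mul_eq_right₀ (norm_ne_zero_iff.2 hv), Real.norm_eq_abs] at h1
  rw [← sq_abs, h1, one_pow]

/-- An isometry that preserves a flag, acting by a positive factor on its second step, has an
orthogonal eigenframe adapted to the flag. -/
theorem exists_isEigenframe (L : E3 ≃ₗᵢ[ℝ] E3) {x₀ x₁ x₂ : E3} {ε τ δ q β κ : ℝ}
    (hli : ∀ a b c : ℝ, a • x₀ + b • x₁ + c • x₂ = 0 → a = 0 ∧ b = 0 ∧ c = 0)
    (hspan : ∀ v, ∃ a b c : ℝ, v = a • x₀ + b • x₁ + c • x₂)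
    (h2 : L x₂ = ε • x₂) (h0 : L x₀ = τ ^ 2 • x₀ + q • x₂)
    (h1 : L x₁ = β • x₀ + δ • x₁ + κ • x₂) :
    τ ^ 2 = 1 ∧ ∃ (s : ℝ) (n : E3), IsEigenframe L x₂ (x₀ - s • x₂) n ε δ := by
  have hx2 : x₂ ≠ 0 := fun h => by simpa using (hli 0 0 1 (by simp [h])).2.2
  have hε := sq_eq_one_of_map_eq_smul L hx2 h2
  have hε0 : ε ≠ 0 := fun h => by simp [h] at hε
  have hn2 : ⟪x₂, x₂⟫_ℝ ≠ 0 := fun h => hx2 (inner_self_eq_zero.1 h)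
  -- Gram–Schmidt in the order `x₂`, `x₀`, `x₁`, compatible with the flag.
  set s := ⟪x₀, x₂⟫_ℝ / ⟪x₂, x₂⟫_ℝ with hs
  set e := x₀ - s • x₂ with he
  have he0 : e ≠ 0 := fun h => by
    simpa using (hli 1 0 (-s) (by rw [← h, he]; module)).1
  have het : ⟪e, x₂⟫_ℝ = 0 := by
    rw [he, inner_sub_left, real_inner_smul_left, hs, div_mul_cancel₀ _ hn2, sub_self]
  have hLe : L e = τ ^ 2 • e + (q + τ ^ 2 * s - s * ε) • x₂ := by
    rw [he, map_sub, map_smul, h0, h2]; module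
  -- An isometry preserves orthogonality of `e` and `x₂`, which kills the off-diagonal coefficient;
  -- the same argument is used for `n` below.
  have hz : q + τ ^ 2 * s - s * ε = 0 := by
    have h3 := L.inner_map_map e x₂
    rw [het, h2, hLe, inner_add_left, real_inner_smul_left, real_inner_smul_left,
      real_inner_smul_right, real_inner_smul_right, het, mul_zero, mul_zero, zero_add] at h3
    simpa [hε0, hx2] using h3
  rw [hz, zero_smul, add_zero] at hLe
  -- An eigenvalue of an isometry has square one, and `τ ^ 2` is nonnegative.
  have hτ : τ ^ 2 = 1 := by
    have h3 := sq_eq_one_of_map_eq_smul L he0 hLe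
    nlinarith [sq_nonneg τ]
  rw [hτ, one_smul] at hLe
  have hne : ⟪e, e⟫_ℝ ≠ 0 := fun h => he0 (inner_self_eq_zero.1 h)
  set a := ⟪x₁, e⟫_ℝ / ⟪e, e⟫_ℝ with ha
  set b := ⟪x₁, x₂⟫_ℝ / ⟪x₂, x₂⟫_ℝ with hb
  set n := x₁ - a • e - b • x₂ with hn
  have hn0 : n ≠ 0 := fun h => by
    simpa using (hli (-a) 1 (a * s - b) (by rw [← h, hn, he]; module)).2.1
  have hnt : ⟪n, x₂⟫_ℝ = 0 := by
    rw [hn, inner_sub_left, inner_sub_left, real_inner_smul_left, real_inner_smul_left, het, hb,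
      div_mul_cancel₀ _ hn2, mul_zero, sub_zero, sub_self]
  have hnE : ⟪n, e⟫_ℝ = 0 := by
    rw [hn, inner_sub_left, inner_sub_left, real_inner_smul_left, real_inner_smul_left,
      real_inner_comm e x₂, het, ha, div_mul_cancel₀ _ hne, mul_zero, sub_self, sub_zero]
  have hLn : L n = δ • n + (β + δ * a - a) • e + (κ + β * s + δ * b - b * ε) • x₂ := by
    have hx0 : x₀ = e + s • x₂ := by rw [he]; module
    have hx1 : x₁ = n + a • e + b • x₂ := by rw [hn]; module
    rw [hn, map_sub, map_sub, map_smul, map_smul, hLe, h1, h2, ← hn, hx0, hx1]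
    module
  have hz1 : β + δ * a - a = 0 := by
    have h3 := L.inner_map_map n e
    rw [hnE, hLe, hLn, inner_add_left, inner_add_left, real_inner_smul_left, real_inner_smul_left,
      real_inner_smul_left, hnE, real_inner_comm e x₂, het, mul_zero, mul_zero, zero_add,
      add_zero] at h3
    exact (mul_eq_zero.1 h3).resolve_right hne
  have hz2 : κ + β * s + δ * b - b * ε = 0 := by
    have h3 := L.inner_map_map n x₂
    rw [hnt, h2, hLn, real_inner_smul_right, inner_add_left, inner_add_left, real_inner_smul_left,
      real_inner_smul_left, real_inner_smul_left, hnt, het, mul_zero, mul_zero, zero_add,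
      zero_add] at h3
    exact (mul_eq_zero.1 ((mul_eq_zero.1 h3).resolve_left hε0)).resolve_right hn2
  rw [hz1, hz2, zero_smul, zero_smul, add_zero, add_zero] at hLn
  refine ⟨hτ, s, n, hx2, he0, hn0, het, hnt, hnE, h2, hLe, hLn, hε,
    sq_eq_one_of_map_eq_smul L hn0 hLn, fun v => ?_⟩
  obtain ⟨a', b', c', hv⟩ := hspan v
  refine ⟨a' * s + b' * b + c', a' + b' * a, b', ?_⟩
  rw [hv, hn, he]; module

/-- An isometry whose linear part is `1` on `D` and `-1` on `Dᗮ` is the reflection in the affine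
subspace through a fixed point with direction `D`. -/
theorem eq_reflectionIn_mk' {T : E3 ≃ᵢ E3} {L : E3 ≃ₗᵢ[ℝ] E3} {x₀ : E3}
    (hT : ∀ x, T x = x₀ + L (x - x₀)) {D : Submodule ℝ E3} (h1 : ∀ v ∈ D, L v = v)
    (h2 : ∀ v ∈ Dᗮ, L v = -v) : T = reflectionIn (AffineSubspace.mk' x₀ D) := by
  ext1 x
  obtain ⟨d, hd, d', hd', hx⟩ := D.exists_add_mem_mem_orthogonal (x - x₀)
  have hx' : x = d' +ᵥ (x₀ + d) := by
    rw [vadd_eq_add]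
    rw [sub_eq_iff_eq_add] at hx
    rw [hx]; abel
  have hmem : x₀ + d ∈ AffineSubspace.mk' x₀ D := by
    rw [AffineSubspace.mem_mk']
    simpa using hd
  have hd'' : d' ∈ (AffineSubspace.mk' x₀ D).directionᗮ := by
    rwa [AffineSubspace.direction_mk']
  have h3 := EuclideanGeometry.reflection_orthogonal_vadd hmem hd''
  rw [hT, hx, map_add, h1 d hd, h2 d' hd']
  conv_rhs => rw [hx']
  refine Eq.trans ?_ h3.symm
  rw [vadd_eq_add]; abel

namespace IsEigenframe

variable {L : E3 ≃ₗᵢ[ℝ] E3} {t e n : E3} {ε δ : ℝ}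

theorem ε_eq (h : IsEigenframe L t e n ε δ) : ε = 1 ∨ ε = -1 :=
  mul_self_eq_one_iff.1 (by rw [← sq, h.sq_ε])
theorem δ_eq (h : IsEigenframe L t e n ε δ) : δ = 1 ∨ δ = -1 :=
  mul_self_eq_one_iff.1 (by rw [← sq, h.sq_δ])

theorem inner_self_ne_zero_of_ne_zero {v : E3} (hv : v ≠ 0) : ⟪v, v⟫_ℝ ≠ 0 :=
  fun h => hv (inner_self_eq_zero.1 h)

theorem map_map (h : IsEigenframe L t e n ε δ) (v : E3) : L (L v) = v := by
  obtain ⟨a, b, c, rfl⟩ := h.span v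
  have h1 : ε * ε = 1 := by rw [← sq, h.sq_ε]
  have h2 : δ * δ = 1 := by rw [← sq, h.sq_δ]
  simp only [map_add, map_smul, h.map_t, h.map_e, h.map_n, smul_smul]
  rw [mul_assoc a, h1, mul_assoc c, h2, mul_one, mul_one]

theorem map_eq_self (h : IsEigenframe L t e n ε δ) (hε : ε = 1) (hδ : δ = 1) (v : E3) :
    L v = v := by
  obtain ⟨a, b, c, rfl⟩ := h.span v
  simp only [map_add, map_smul, h.map_t, h.map_e, h.map_n, hε, hδ, one_smul]

theorem exists_of_inner_t (h : IsEigenframe L t e n ε δ) {v : E3} (hv : ⟪v, t⟫_ℝ = 0) :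
    ∃ b c : ℝ, v = b • e + c • n := by
  obtain ⟨a, b, c, rfl⟩ := h.span v
  rw [inner_add_left, inner_add_left, real_inner_smul_left, real_inner_smul_left,
    real_inner_smul_left, h.inner_e_t, h.inner_n_t, mul_zero, mul_zero, add_zero, add_zero] at hv
  have ha := (mul_eq_zero.1 hv).resolve_right (inner_self_ne_zero_of_ne_zero h.t_ne)
  exact ⟨b, c, by rw [ha]; module⟩

theorem exists_of_inner_n (h : IsEigenframe L t e n ε δ) {v : E3} (hv : ⟪v, n⟫_ℝ = 0) :
    ∃ a b : ℝ, v = a • t + b • e := by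
  obtain ⟨a, b, c, rfl⟩ := h.span v
  rw [inner_add_left, inner_add_left, real_inner_smul_left, real_inner_smul_left,
    real_inner_smul_left, real_inner_comm n e, h.inner_n_e, real_inner_comm n t, h.inner_n_t,
    mul_zero, mul_zero, add_zero, zero_add] at hv
  have hc := (mul_eq_zero.1 hv).resolve_right (inner_self_ne_zero_of_ne_zero h.n_ne)
  exact ⟨a, b, by rw [hc]; module⟩

theorem exists_of_inner_e (h : IsEigenframe L t e n ε δ) {v : E3} (hv : ⟪v, e⟫_ℝ = 0) :
    ∃ a c : ℝ, v = a • t + c • n := by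
  obtain ⟨a, b, c, rfl⟩ := h.span v
  rw [inner_add_left, inner_add_left, real_inner_smul_left, real_inner_smul_left,
    real_inner_smul_left, real_inner_comm e t, h.inner_e_t, h.inner_n_e,
    mul_zero, mul_zero, add_zero, zero_add] at hv
  have hb := (mul_eq_zero.1 hv).resolve_right (inner_self_ne_zero_of_ne_zero h.e_ne)
  exact ⟨a, c, by rw [hb]; module⟩

/-- The last vector of an eigenframe may be replaced by any nonzero vector orthogonal to the
first two. -/
theorem replace_n (h : IsEigenframe L t e n ε δ) {ν : E3} (hν : ν ≠ 0) (h1 : ⟪ν, t⟫_ℝ = 0)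
    (h2 : ⟪ν, e⟫_ℝ = 0) : IsEigenframe L t e ν ε δ := by
  obtain ⟨b, c, hbc⟩ := h.exists_of_inner_t h1
  have hb : b = 0 := by
    rw [hbc, inner_add_left, real_inner_smul_left, real_inner_smul_left, h.inner_n_e, mul_zero,
      add_zero] at h2
    exact (mul_eq_zero.1 h2).resolve_right (inner_self_ne_zero_of_ne_zero h.e_ne)
  rw [hb, zero_smul, zero_add] at hbc
  have hc : c ≠ 0 := fun hc => hν (by rw [hbc, hc, zero_smul])
  refine { h with n_ne := hν, inner_n_t := h1, inner_n_e := h2, map_n := ?_, span := fun v => ?_ }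
  · rw [hbc, map_smul, h.map_n, smul_comm]
  · obtain ⟨x, y, z, hv⟩ := h.span v
    exact ⟨x, y, z / c, by rw [hv, hbc, smul_smul, div_mul_cancel₀ _ hc]⟩

variable {T : E3 ≃ᵢ E3} {x₀ : E3}

theorem eq_reflectionIn_of_neg_one (h : IsEigenframe L t e n ε δ) (hT : ∀ x, T x = x₀ + L (x - x₀))
    (hε : ε = -1) (hδ : δ = 1) :
    T = reflectionIn (AffineSubspace.mk' x₀ (Submodule.span ℝ {t})ᗮ) := by
  refine eq_reflectionIn_mk' hT (fun v hv => ?_) (fun v hv => ?_)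
  · obtain ⟨b, c, rfl⟩ := h.exists_of_inner_t
      (Submodule.mem_orthogonal_singleton_iff_inner_left.1 hv)
    simp [h.map_e, h.map_n, hδ]
  · rw [Submodule.orthogonal_orthogonal, Submodule.mem_span_singleton] at hv
    obtain ⟨a, rfl⟩ := hv
    simp [h.map_t, hε]

theorem eq_reflectionIn_of_one (h : IsEigenframe L t e n ε δ) (hT : ∀ x, T x = x₀ + L (x - x₀))
    (hε : ε = 1) (hδ : δ = -1) :
    T = reflectionIn (AffineSubspace.mk' x₀ (Submodule.span ℝ {n})ᗮ) := by
  refine eq_reflectionIn_mk' hT (fun v hv => ?_) (fun v hv => ?_)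
  · obtain ⟨b, c, rfl⟩ := h.exists_of_inner_n
      (Submodule.mem_orthogonal_singleton_iff_inner_left.1 hv)
    simp [h.map_e, h.map_t, hε]
  · rw [Submodule.orthogonal_orthogonal, Submodule.mem_span_singleton] at hv
    obtain ⟨a, rfl⟩ := hv
    simp [h.map_n, hδ]

/-- Both `t` and `n` are negated, so the fixed space is the line of `e`, which is `nᗮ ⊓ tᗮ`: a
half-turn. -/
theorem eq_reflectionIn_of_neg_one_neg_one (h : IsEigenframe L t e n ε δ)
    (hT : ∀ x, T x = x₀ + L (x - x₀)) (hε : ε = -1) (hδ : δ = -1) :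
    T = reflectionIn (AffineSubspace.mk' x₀
      ((Submodule.span ℝ {n})ᗮ ⊓ (Submodule.span ℝ {t})ᗮ)) := by
  refine eq_reflectionIn_mk' hT (fun v hv => ?_) (fun v hv => ?_)
  · rw [Submodule.mem_inf, Submodule.mem_orthogonal_singleton_iff_inner_left,
      Submodule.mem_orthogonal_singleton_iff_inner_left] at hv
    obtain ⟨b, c, rfl⟩ := h.exists_of_inner_n hv.1
    have hv2 := hv.2
    rw [inner_add_left, real_inner_smul_left, real_inner_smul_left, h.inner_e_t, mul_zero,
      add_zero] at hv2
    have hb := (mul_eq_zero.1 hv2).resolve_right (inner_self_ne_zero_of_ne_zero h.t_ne)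
    simp [h.map_e, hb]
  · have he : e ∈ (Submodule.span ℝ {n})ᗮ ⊓ (Submodule.span ℝ {t})ᗮ := by
      rw [Submodule.mem_inf, Submodule.mem_orthogonal_singleton_iff_inner_left,
        Submodule.mem_orthogonal_singleton_iff_inner_left, real_inner_comm]
      exact ⟨h.inner_n_e, h.inner_e_t⟩
    obtain ⟨a, c, rfl⟩ := h.exists_of_inner_e ((Submodule.mem_orthogonal' _ _).1 hv e he)
    simp [h.map_t, h.map_n, hε, hδ]
    abel

end IsEigenframe

/-! ### Normal form charts and the geometry of `f` at `p` -/

/-- `φ` and `Φ` are `C^r`-charts at `p` and `f p` that bring `f` into the normal form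
`foldedMap c`. -/
structure IsFoldChart (r : WithTop ℕ∞) (c : ℝ → ℝ) (f : ℝ × ℝ → E3) (p : ℝ × ℝ)
    (φ : OpenPartialHomeomorph (ℝ × ℝ) (ℝ × ℝ)) (Φ : OpenPartialHomeomorph E3 E3) : Prop where
  coeff : IsFoldCoeff c
  smooth : SmoothNear r f p
  mem_source : p ∈ φ.source
  apply_eq : φ p = 0
  mem_source' : f p ∈ Φ.source
  apply_eq' : Φ (f p) = 0
  smooth_φ : SmoothNear r φ p
  smooth_φ_symm : SmoothNear r φ.symm 0
  smooth_Φ : SmoothNear r Φ (f p)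
  smooth_Φ_symm : SmoothNear r Φ.symm 0
  comm : ∀ᶠ q in 𝓝 p, Φ (f q) = foldedMap c (φ q)

theorem RightLeftEquivAt.exists_isFoldChart {r : WithTop ℕ∞} {c : ℝ → ℝ} (hc : IsFoldCoeff c)
    {f : ℝ × ℝ → E3} {p : ℝ × ℝ} (hf : SmoothNear r f p)
    (h : RightLeftEquivAt r f p (foldedMap c) (0, 0)) : ∃ φ Φ, IsFoldChart r c f p φ Φ := by
  obtain ⟨φ, Φ, h1, h2, h3, h4, h5, h6, h7, h8, h9⟩ := h
  have h2' : φ p = 0 := h2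
  have h4' : Φ (f p) = 0 := by rw [h4]; exact foldedMap_zero c
  exact ⟨φ, Φ, hc, hf, h1, h2', h3, h4', h5.smoothNear φ.open_source h1,
    h6.smoothNear φ.open_target (h2' ▸ φ.map_source h1), h7.smoothNear Φ.open_source h3,
    h8.smoothNear Φ.open_target (h4' ▸ Φ.map_source h3), h9⟩

/-- The components `v²` and `u` alone form an immersion off the axis, whatever `c` is. -/
theorem fderiv_foldedMap_injective {c : ℝ → ℝ} (hc : IsFoldCoeff c) {x w : ℝ × ℝ} (hx : x.2 ≠ 0)
    (hw : fderiv ℝ (foldedMap c) x w = 0) : w = 0 := by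
  have h1 : HasFDerivAt (foldedMap c) (fderiv ℝ (foldedMap c) x) x :=
    ((contDiff_foldedMap hc (r := 1)).differentiable one_ne_zero).differentiableAt.hasFDerivAt
  have h2 : ∀ i : Fin 3, HasFDerivAt (fun x => foldedMap c x i)
      ((EuclideanSpace.proj i : E3 →L[ℝ] ℝ).comp (fderiv ℝ (foldedMap c) x)) x := fun i =>
    (EuclideanSpace.proj i : E3 →L[ℝ] ℝ).hasFDerivAt.comp x h1
  have h3 := DFunLike.congr_fun ((h2 2).unique hasFDerivAt_fst) w
  have h4 := DFunLike.congr_fun ((h2 0).unique ((hasFDerivAt_snd (p := x)).pow 2)) w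
  simp [hw] at h3 h4
  exact Prod.ext h3.symm (h4.resolve_left hx)

namespace IsFoldChart

variable {r : WithTop ℕ∞} {c : ℝ → ℝ} {f : ℝ × ℝ → E3} {p : ℝ × ℝ}
  {φ : OpenPartialHomeomorph (ℝ × ℝ) (ℝ × ℝ)} {Φ : OpenPartialHomeomorph E3 E3}

theorem symm_zero (h : IsFoldChart r c f p φ Φ) : φ.symm 0 = p := by
  rw [← h.apply_eq, φ.left_inv h.mem_source]

theorem symm_zero' (h : IsFoldChart r c f p φ Φ) : Φ.symm 0 = f p := by
  rw [← h.apply_eq', Φ.left_inv h.mem_source']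

theorem zero_mem_target (h : IsFoldChart r c f p φ Φ) : (0 : ℝ × ℝ) ∈ φ.target :=
  h.apply_eq ▸ φ.map_source h.mem_source

theorem zero_mem_target' (h : IsFoldChart r c f p φ Φ) : (0 : E3) ∈ Φ.target :=
  h.apply_eq' ▸ Φ.map_source h.mem_source'

theorem tendsto_φ (h : IsFoldChart r c f p φ Φ) : Tendsto φ (𝓝 p) (𝓝 0) := by
  simpa [h.apply_eq] using (φ.continuousAt h.mem_source).tendsto

theorem tendsto_φ_symm (h : IsFoldChart r c f p φ Φ) : Tendsto φ.symm (𝓝 0) (𝓝 p) := by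
  simpa [h.symm_zero] using (φ.continuousAt_symm h.zero_mem_target).tendsto

theorem tendsto_Φ_symm (h : IsFoldChart r c f p φ Φ) : Tendsto Φ.symm (𝓝 0) (𝓝 (f p)) := by
  simpa [h.symm_zero'] using (Φ.continuousAt_symm h.zero_mem_target').tendsto

theorem eventually_mem_source (h : IsFoldChart r c f p φ Φ) : ∀ᶠ q in 𝓝 p, q ∈ φ.source :=
  φ.open_source.mem_nhds h.mem_source

theorem eventually_mem_target (h : IsFoldChart r c f p φ Φ) : ∀ᶠ x in 𝓝 0, x ∈ φ.target :=
  φ.open_target.mem_nhds h.zero_mem_target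

theorem eventually_mem_source' (h : IsFoldChart r c f p φ Φ) : ∀ᶠ x in 𝓝 (f p), x ∈ Φ.source :=
  Φ.open_source.mem_nhds h.mem_source'

theorem eventually_mem_target' (h : IsFoldChart r c f p φ Φ) : ∀ᶠ x in 𝓝 0, x ∈ Φ.target :=
  Φ.open_target.mem_nhds h.zero_mem_target'

theorem tendsto_f (h : IsFoldChart r c f p φ Φ) : Tendsto f (𝓝 p) (𝓝 (f p)) :=
  h.smooth.contDiffAt.continuousAt

theorem eventually_eq (h : IsFoldChart r c f p φ Φ) :
    ∀ᶠ q in 𝓝 p, f q = Φ.symm (foldedMap c (φ q)) := by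
  filter_upwards [h.comm, h.tendsto_f.eventually h.eventually_mem_source'] with q h1 h2
  rw [← h1, Φ.left_inv h2]

theorem fderiv_fderiv_symm {E : Type*} [NormedAddCommGroup E] [NormedSpace ℝ E] {a b : E → E}
    {x : E} (ha : DifferentiableAt ℝ a (b x)) (hb : DifferentiableAt ℝ b x)
    (hab : ∀ᶠ y in 𝓝 x, a (b y) = y) (v : E) : fderiv ℝ a (b x) (fderiv ℝ b x v) = v := by
  have h1 := ha.hasFDerivAt.comp x hb.hasFDerivAt
  have h2 : HasFDerivAt (a ∘ b) (ContinuousLinearMap.id ℝ E) x :=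
    (hasFDerivAt_id x).congr_of_eventuallyEq hab
  exact DFunLike.congr_fun (h1.unique h2) v

theorem fderiv_symm_fderiv_φ (h : IsFoldChart r c f p φ Φ) (hr : r ≠ 0) :
    ∀ᶠ q in 𝓝 p, ∀ v, fderiv ℝ φ.symm (φ q) (fderiv ℝ φ q v) = v := by
  filter_upwards [h.tendsto_φ.eventually h.smooth_φ_symm, h.smooth_φ,
    h.eventually_mem_source.eventually_nhds] with q h1 h2 h3 v
  exact fderiv_fderiv_symm (h1.differentiableAt hr) (h2.differentiableAt hr)
    (h3.mono fun y hy => φ.left_inv hy) v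

theorem fderiv_φ_fderiv_symm (h : IsFoldChart r c f p φ Φ) (hr : r ≠ 0) (v : ℝ × ℝ) :
    fderiv ℝ φ p (fderiv ℝ φ.symm 0 v) = v := by
  have h1 := h.smooth_φ
  rw [← h.symm_zero] at h1
  have := fderiv_fderiv_symm (h1.contDiffAt.differentiableAt hr)
    (h.smooth_φ_symm.contDiffAt.differentiableAt hr)
    (h.eventually_mem_target.mono fun y hy => φ.right_inv hy) v
  rwa [h.symm_zero] at this

theorem fderiv_Φ_fderiv_symm (h : IsFoldChart r c f p φ Φ) (hr : r ≠ 0) (v : E3) :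
    fderiv ℝ Φ (f p) (fderiv ℝ Φ.symm 0 v) = v := by
  have h1 := h.smooth_Φ
  rw [← h.symm_zero'] at h1
  have := fderiv_fderiv_symm (h1.contDiffAt.differentiableAt hr)
    (h.smooth_Φ_symm.contDiffAt.differentiableAt hr)
    (h.eventually_mem_target'.mono fun y hy => Φ.right_inv hy) v
  rwa [h.symm_zero'] at this

theorem fderiv_symm_fderiv_Φ (h : IsFoldChart r c f p φ Φ) (hr : r ≠ 0) (v : E3) :
    fderiv ℝ Φ.symm 0 (fderiv ℝ Φ (f p) v) = v := by
  have h1 := h.smooth_Φ_symm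
  rw [← h.apply_eq'] at h1
  have := fderiv_fderiv_symm (h1.contDiffAt.differentiableAt hr)
    (h.smooth_Φ.contDiffAt.differentiableAt hr)
    (h.eventually_mem_source'.mono fun y hy => Φ.left_inv hy) v
  rwa [h.apply_eq'] at this

/-- The image under the target chart of the standard basis. -/
def basisVec (_ : IsFoldChart r c f p φ Φ) (i : Fin 3) : E3 := fderiv ℝ Φ.symm 0 (stdVec i)

theorem fderiv_apply (h : IsFoldChart r c f p φ Φ) (hr : r ≠ 0) (w : ℝ × ℝ) :
    fderiv ℝ f p w = (fderiv ℝ φ p w).1 • h.basisVec 2 := by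
  have h1 : HasFDerivAt φ (fderiv ℝ φ p) p :=
    (h.smooth_φ.contDiffAt.differentiableAt hr).hasFDerivAt
  have h2 := hasFDerivAt_foldedMap_zero h.coeff
  have h3 : HasFDerivAt Φ.symm (fderiv ℝ Φ.symm 0) 0 :=
    (h.smooth_Φ_symm.contDiffAt.differentiableAt hr).hasFDerivAt
  rw [← foldedMap_zero c] at h3
  rw [← h.apply_eq] at h2
  have h3' := h3
  rw [show foldedMap c 0 = foldedMap c (φ p) by rw [h.apply_eq]] at h3'
  have h4 := (h3'.comp p (h2.comp p h1)).congr_of_eventuallyEq h.eventually_eq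
  rw [h4.fderiv, h.apply_eq, foldedMap_zero]
  simp [basisVec]

theorem tangentDirection_eq (h : IsFoldChart r c f p φ Φ) (hr : r ≠ 0) :
    tangentDirection f p = Submodule.span ℝ {h.basisVec 2} := by
  ext v
  rw [Submodule.mem_span_singleton, LinearMap.mem_range]
  constructor
  · rintro ⟨w, rfl⟩
    exact ⟨_, (h.fderiv_apply hr w).symm⟩
  · rintro ⟨a, rfl⟩
    refine ⟨fderiv ℝ φ.symm 0 (a, 0), ?_⟩
    rw [ContinuousLinearMap.coe_coe, h.fderiv_apply hr, h.fderiv_φ_fderiv_symm hr]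

theorem snd_eq_zero_of_singular (h : IsFoldChart r c f p φ Φ) (hr : r ≠ 0) :
    ∀ᶠ q in 𝓝 p, ¬ Function.Injective (fderiv ℝ f q) → (φ q).2 = 0 := by
  filter_upwards [h.comm.eventually_nhds, h.smooth, h.tendsto_f.eventually h.smooth_Φ, h.smooth_φ,
    h.fderiv_symm_fderiv_φ hr] with q h1 h2 h3 h4 h5 hq
  by_contra hne
  refine hq ((injective_iff_map_eq_zero _).2 fun w hw => ?_)
  have e1 := (h3.differentiableAt hr).hasFDerivAt.comp q (h2.differentiableAt hr).hasFDerivAt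
  have e2 : HasFDerivAt (foldedMap c) (fderiv ℝ (foldedMap c) (φ q)) (φ q) :=
    ((contDiff_foldedMap h.coeff (r := 1)).differentiable one_ne_zero).differentiableAt.hasFDerivAt
  have e3 := (e2.comp q (h4.differentiableAt hr).hasFDerivAt).congr_of_eventuallyEq h1
  have e4 := DFunLike.congr_fun (e1.unique e3) w
  simp only [ContinuousLinearMap.comp_apply, hw, map_zero] at e4
  have e5 := fderiv_foldedMap_injective h.coeff hne e4.symm
  rw [← h5 w, e5, map_zero]

theorem inner_basisVec_two (h : IsFoldChart r c f p φ Φ) (hr : r ≠ 0) {ν : ℝ × ℝ → E3}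
    (hν : IsUnitNormalNear r f ν p) : ⟪h.basisVec 2, ν p⟫_ℝ = 0 := by
  have h1 := hν.self_of_nhds.2.2 (fderiv ℝ φ.symm 0 (1, 0))
  rwa [h.fderiv_apply hr, h.fderiv_φ_fderiv_symm hr, one_smul] at h1

/-- At `p` the derivative of `f` has rank one and says nothing about this direction, so a limit is
needed. At the point with chart coordinates `(0, v)`, the `v`-derivative of `f` is `2 v` times the
image of `stdVec 0 + (3/2 * c 0 * v) • stdVec 1` under the derivative of `Φ.symm`. It is orthogonal
to `ν`; divide by `2 v` and let `v → 0`. -/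
theorem inner_basisVec_zero (h : IsFoldChart r c f p φ Φ) (hr1 : 1 ≤ r) {ν : ℝ × ℝ → E3}
    (hν : IsUnitNormalNear r f ν p) : ⟪h.basisVec 0, ν p⟫_ℝ = 0 := by
  have hr : r ≠ 0 := by rintro rfl; simp at hr1
  have t1 : Tendsto (fun v : ℝ => ((0 : ℝ), v)) (𝓝 0) (𝓝 0) :=
    (by fun_prop : Continuous fun v : ℝ => ((0 : ℝ), v)).tendsto' 0 _ rfl
  have t2 := h.tendsto_φ_symm.comp t1
  have t3 := (IsChartSymmetry.tendsto_foldedMap h.coeff).comp t1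
  let w : ℝ → E3 := fun v => stdVec 0 + (3 / 2 * c 0 * v) • stdVec 1
  have hw : Tendsto w (𝓝[≠] 0) (𝓝 (stdVec 0)) :=
    ((by fun_prop : Continuous w).tendsto' 0 _ (by simp [w])).mono_left nhdsWithin_le_nhds
  have hcd : ContinuousAt (fderiv ℝ Φ.symm) 0 :=
    ((h.smooth_Φ_symm.contDiffAt.of_le hr1).fderiv_right (m := 0) (by simp)).continuousAt
  have hlim : Tendsto (fun v => ⟪fderiv ℝ Φ.symm (foldedMap c (0, v)) (w v),
      ν (φ.symm (0, v))⟫_ℝ) (𝓝[≠] 0) (𝓝 ⟪h.basisVec 0, ν p⟫_ℝ) := by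
    refine Tendsto.inner ?_ ?_
    · exact (isBoundedBilinearMap_apply.continuous.tendsto (fderiv ℝ Φ.symm 0, stdVec 0)).comp
        (((hcd.tendsto.comp t3).mono_left nhdsWithin_le_nhds).prodMk_nhds hw)
    · exact (hν.self_of_nhds.1.continuousAt.tendsto.comp t2).mono_left nhdsWithin_le_nhds
  refine tendsto_nhds_unique hlim (tendsto_const_nhds.congr' ?_)
  have ne : ∀ᶠ v : ℝ in 𝓝[≠] 0, v ≠ 0 := eventually_mem_nhdsWithin
  filter_upwards [(t2.eventually hν).filter_mono nhdsWithin_le_nhds,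
    (t2.eventually h.smooth).filter_mono nhdsWithin_le_nhds,
    (t1.eventually h.smooth_φ_symm).filter_mono nhdsWithin_le_nhds,
    (t1.eventually h.eventually_mem_target.eventually_nhds).filter_mono nhdsWithin_le_nhds,
    (t3.eventually h.smooth_Φ_symm).filter_mono nhdsWithin_le_nhds,
    (t2.eventually h.eventually_eq.eventually_nhds).filter_mono nhdsWithin_le_nhds, ne]
    with v h1 h2 h3 h4 h5 h6 hv
  have d0 : HasDerivAt (fun v : ℝ => ((0 : ℝ), v)) ((0 : ℝ), (1 : ℝ)) v :=
    (hasDerivAt_const v (0 : ℝ)).prodMk (hasDerivAt_id v)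
  have d1 : HasDerivAt (fun v : ℝ => foldedMap c (0, v)) ((2 * v) • w v) v := by
    have e1 : (fun v : ℝ => foldedMap c (0, v)) = fun v : ℝ =>
      v ^ 2 • stdVec 0 + (c 0 * v ^ 3) • stdVec 1 + (0 : ℝ) • stdVec 2 :=
        funext fun v => foldedMap_eq c _
    rw [e1]
    have f1 := (hasDerivAt_pow 2 v).smul_const (stdVec 0)
    have f2 := ((hasDerivAt_pow 3 v).const_mul (c 0)).smul_const (stdVec 1)
    convert! (f1.add f2).add_const ((0 : ℝ) • stdVec 2) using 1
    simp only [w]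
    norm_num
    module
  have d2 := (h3.differentiableAt hr).hasFDerivAt.comp_hasDerivAt v d0
  have d3 := (h2.differentiableAt hr).hasFDerivAt.comp_hasDerivAt v d2
  have d4 := (h5.differentiableAt hr).hasFDerivAt.comp_hasDerivAt v d1
  have hEq : f ∘ (φ.symm ∘ fun v : ℝ => ((0 : ℝ), v)) =ᶠ[𝓝 v]
      Φ.symm ∘ fun v : ℝ => foldedMap c (0, v) := by
    have t4 : Tendsto (fun v : ℝ => φ.symm (0, v)) (𝓝 v) (𝓝 (φ.symm (0, v))) := d2.continuousAt
    filter_upwards [t4.eventually h6, d0.continuousAt.eventually h4] with y h7 h8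
    simp only [Function.comp_apply] at h7 h8 ⊢
    rw [h7, φ.right_inv h8]
  have d5 := d3.unique (d4.congr_of_eventuallyEq hEq)
  have h7 := h1.2.2 (fderiv ℝ φ.symm (0, v) (0, 1))
  have d6 : fderiv ℝ f (φ.symm (0, v)) (fderiv ℝ φ.symm (0, v) (0, 1)) =
      (2 * v) • fderiv ℝ Φ.symm (foldedMap c (0, v)) (w v) := by
    rw [← map_smul]; exact d5
  simp only [Function.comp_apply] at h7
  rw [d6, real_inner_smul_left] at h7
  exact ((mul_eq_zero.1 h7).resolve_left (by simpa using hv)).symm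

end IsFoldChart

/-! ### Double points and rigidity -/

theorem frequently_fst_ne_zero (x : ℝ × ℝ) : ∃ᶠ y in 𝓝 x, y.1 ≠ 0 := by
  have h : Tendsto Prod.swap (𝓝 x.swap) (𝓝 x) := continuous_swap.tendsto' _ _ (Prod.swap_swap x)
  exact h.frequently (frequently_snd_ne_zero x.swap)

/-- Equal images have equal `u` and opposite or equal `v`; opposite values give `c(u) v³ = 0`. Hence
the edge is injective and the cross cap has double points only over `u = 0`. -/
theorem foldedMap_eq_iff {c : ℝ → ℝ} {x y : ℝ × ℝ} (h : foldedMap c x = foldedMap c y) :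
    x.1 = y.1 ∧ (x.2 = y.2 ∨ (c x.1 = 0 ∧ x.2 = -y.2)) := by
  have h0 : x.2 ^ 2 = y.2 ^ 2 := congrArg (fun X : E3 => X 0) h
  have h1 : c x.1 * x.2 ^ 3 = c y.1 * y.2 ^ 3 := congrArg (fun X : E3 => X 1) h
  have h2 : x.1 = y.1 := congrArg (fun X : E3 => X 2) h
  refine ⟨h2, ?_⟩
  rcases sq_eq_sq_iff_eq_or_eq_neg.1 h0 with h3 | h3
  · exact .inl h3
  · by_cases hc : c x.1 = 0
    · exact .inr ⟨hc, h3⟩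
    · left
      rw [h3, ← h2] at h1
      have h4 : c x.1 * y.2 ^ 3 = 0 := by linear_combination (-1 / 2) * h1
      have h5 : y.2 = 0 := by simpa [hc] using h4
      rw [h3, h5, neg_zero]

/-- By the Mazur–Ulam theorem, a bijective isometry is affine. -/
theorem exists_linearIsometryEquiv {T : E3 ≃ᵢ E3} {x₀ : E3} (h : T x₀ = x₀) :
    ∃ L : E3 ≃ₗᵢ[ℝ] E3, ∀ x, T x = x₀ + L (x - x₀) := by
  refine ⟨T.toRealAffineIsometryEquiv.linearIsometryEquiv, fun x => ?_⟩
  have h1 := T.toRealAffineIsometryEquiv.map_vadd x₀ (x - x₀)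
  simp only [vadd_eq_add, sub_add_cancel, IsometryEquiv.coeFn_toRealAffineIsometryEquiv, h] at h1
  rw [h1, add_comm]

namespace IsFoldChart

variable {r : WithTop ℕ∞} {c : ℝ → ℝ} {f : ℝ × ℝ → E3} {p : ℝ × ℝ}
  {φ : OpenPartialHomeomorph (ℝ × ℝ) (ℝ × ℝ)} {Φ : OpenPartialHomeomorph E3 E3}

/-- A germ of a continuous map over which `f` is invariant is the identity. -/
theorem eventually_eq_id (h : IsFoldChart r c f p φ Φ) {χ : ℝ × ℝ → ℝ × ℝ}
    (hχ : ∀ᶠ q in 𝓝 p, ContinuousAt χ q) (hp : χ p = p) (hf : ∀ᶠ q in 𝓝 p, f (χ q) = f q) :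
    ∀ᶠ q in 𝓝 p, χ q = q := by
  have hχp : Tendsto χ (𝓝 p) (𝓝 p) := by simpa [hp] using hχ.self_of_nhds.tendsto
  -- Where the chart coordinate `u` is nonzero the normal form has no double points; continuity of
  -- `χ` then covers the remaining line.
  have key : ∀ᶠ q in 𝓝 p, (φ q).1 ≠ 0 → χ q = q := by
    filter_upwards [hf, h.comm, hχp.eventually h.comm, h.eventually_mem_source,
      hχp.eventually h.eventually_mem_source] with q h1 h2 h3 h4 h5 hne
    rw [h1, h2] at h3
    obtain ⟨h6, h7⟩ := foldedMap_eq_iff h3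
    have h8 := h7.resolve_right fun h9 => h.coeff.ne_zero hne h9.1
    exact (φ.injOn h4 h5 (Prod.ext h6 h8)).symm
  have hfreq : ∀ᶠ x in 𝓝 p, ∃ᶠ y in 𝓝 x, (φ y).1 ≠ 0 := by
    filter_upwards [h.eventually_mem_source] with x hx
    have t := (φ.continuousAt_symm (φ.map_source hx)).tendsto
    rw [φ.left_inv hx] at t
    refine t.frequently (((frequently_fst_ne_zero (φ x)).and_eventually
      (φ.open_target.mem_nhds (φ.map_source hx))).mono fun y hy => ?_)
    rw [φ.right_inv hy.2]
    exact hy.1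
  have e1 := eventually_eq_of_frequently (f := fun q => (χ q).1) (g := fun q => q.1)
    (hχ.mono fun q hq => hq.fst) (Eventually.of_forall fun q => continuousAt_fst) hfreq
    (key.mono fun q hq h0 => by rw [hq h0])
  have e2 := eventually_eq_of_frequently (f := fun q => (χ q).2) (g := fun q => q.2)
    (hχ.mono fun q hq => hq.snd) (Eventually.of_forall fun q => continuousAt_snd) hfreq
    (key.mono fun q hq h0 => by rw [hq h0])
  filter_upwards [e1, e2] with q h1 h2 using Prod.ext h1 h2

theorem exists_injOn (h : IsFoldChart r (fun _ => 1) f p φ Φ) : ∃ N ∈ 𝓝 p, Set.InjOn f N := by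
  refine ⟨_, h.comm.and h.eventually_mem_source, fun x hx y hy hxy => ?_⟩
  have h1 : foldedMap (fun _ => 1) (φ x) = foldedMap (fun _ => 1) (φ y) := by
    rw [← hx.1, ← hy.1, hxy]
  obtain ⟨h2, h3⟩ := foldedMap_eq_iff h1
  exact φ.injOn hx.2 hy.2 (Prod.ext h2 (h3.resolve_right fun h4 => one_ne_zero h4.1))

/-- The points `(0, v)` and `(0, -v)` have the same image. With `exists_injOn` this tells the two
singularities apart. -/
theorem not_injOn (h : IsFoldChart r id f p φ Φ) {N : Set (ℝ × ℝ)} (hN : N ∈ 𝓝 p) :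
    ¬ Set.InjOn f N := by
  intro hinj
  have t : Tendsto (fun v : ℝ => ((0 : ℝ), v)) (𝓝 0) (𝓝 0) :=
    (by fun_prop : Continuous fun v : ℝ => ((0 : ℝ), v)).tendsto' 0 _ rfl
  have t' : Tendsto (fun v : ℝ => ((0 : ℝ), -v)) (𝓝 0) (𝓝 0) :=
    (by fun_prop : Continuous fun v : ℝ => ((0 : ℝ), -v)).tendsto' 0 _ (by simp)
  have hN' : ∀ᶠ q in 𝓝 p, q ∈ N := hN
  have ev := (h.tendsto_φ_symm.eventually (hN'.and h.eventually_eq)).and h.eventually_mem_target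
  have ne : ∀ᶠ v : ℝ in 𝓝[≠] 0, v ≠ 0 := eventually_mem_nhdsWithin
  obtain ⟨v, h1, h2, hv⟩ := (((t.eventually ev).filter_mono nhdsWithin_le_nhds).and
    (((t'.eventually ev).filter_mono nhdsWithin_le_nhds).and ne)).exists
  have h3 : f (φ.symm (0, v)) = f (φ.symm (0, -v)) := by
    rw [h1.1.2, h2.1.2, φ.right_inv h1.2, φ.right_inv h2.2]
    simp [foldedMap]
  have h4 := φ.symm.injOn h1.2 h2.2 (hinj h1.1.1 h2.1.1 h3)
  have h5 : v = -v := congrArg Prod.snd h4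
  exact hv (by linarith)

/-! ### Transporting the symmetry to the chart and the lift back -/

section Symmetry

variable {T : E3 ≃ᵢ E3} {L : E3 ≃ₗᵢ[ℝ] E3}

theorem hasFDerivAt_isometry (hL : ∀ x, T x = f p + L (x - f p)) (x : E3) :
    HasFDerivAt T (L : E3 →L[ℝ] E3) x := by
  have : (T : E3 → E3) = fun x => f p + L (x - f p) := funext hL
  rw [this]
  exact ((L : E3 →L[ℝ] E3).hasFDerivAt.comp x ((hasFDerivAt_id x).sub_const (f p))).const_add (f p)

theorem contDiff_isometry (hL : ∀ x, T x = f p + L (x - f p)) : ContDiff ℝ r T := by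
  have : (T : E3 → E3) = fun x => f p + L (x - f p) := funext hL
  rw [this]
  exact contDiff_const.add (L.contDiff.comp (contDiff_id.sub contDiff_const))

theorem tendsto_chartMap (h : IsFoldChart r c f p φ Φ) (hT : T (f p) = f p) :
    Tendsto (fun X => T (Φ.symm X)) (𝓝 0) (𝓝 (f p)) := by
  have := (T.continuous.tendsto (f p)).comp h.tendsto_Φ_symm
  rwa [hT] at this

theorem smooth_chartMap (h : IsFoldChart r c f p φ Φ) (hT : T (f p) = f p)
    (hL : ∀ x, T x = f p + L (x - f p)) : SmoothNear r (fun X => Φ (T (Φ.symm X))) 0 := by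
  refine h.smooth_Φ.comp_of_eq (((contDiff_isometry hL).smoothNear _).comp h.smooth_Φ_symm) ?_
  rw [h.symm_zero', hT]

/-- The derivative is injective because `T.symm`, conjugated in the same way, gives a left inverse
germ. -/
theorem isChartSymmetry (h : IsFoldChart r c f p φ Φ) (hr : r ≠ 0) {U : Set (ℝ × ℝ)}
    (hU : IsOpen U) (hpU : p ∈ U) (hT : T (f p) = f p) (hL : ∀ x, T x = f p + L (x - f p))
    (hinv : PreservesImageGerm T f U p) :
    IsChartSymmetry r c (fun X => Φ (T (Φ.symm X))) where
  smooth := h.smooth_chartMap hT hL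
  map_zero := by rw [h.symm_zero', hT, h.apply_eq']
  injective := by
    have hL' : ∀ x, T.symm x = f p + L.symm (x - f p) := fun x => by
      rw [IsometryEquiv.symm_apply_eq, hL]; simp
    have hT' : T.symm (f p) = f p := by rw [IsometryEquiv.symm_apply_eq, hT]
    have h1 := h.smooth_chartMap hT hL
    have h2 := h.smooth_chartMap hT' hL'
    have h0 : Φ (T (Φ.symm 0)) = 0 := by rw [h.symm_zero', hT, h.apply_eq']
    have tS : Tendsto (fun X => Φ (T (Φ.symm X))) (𝓝 0) (𝓝 0) := by
      simpa [h0] using h1.contDiffAt.continuousAt.tendsto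
    have hinv : ∀ᶠ X in 𝓝 0, Φ (T.symm (Φ.symm (Φ (T (Φ.symm X))))) = X := by
      filter_upwards [(h.tendsto_chartMap hT).eventually h.eventually_mem_source',
        h.eventually_mem_target'] with X h3 h4
      rw [Φ.left_inv h3, T.symm_apply_apply, Φ.right_inv h4]
    filter_upwards [h1, tS.eventually h2, hinv.eventually_nhds] with X h3 h4 h5
    refine Function.LeftInverse.injective (fun v => ?_) (g :=
      fderiv ℝ (fun X => Φ (T.symm (Φ.symm X))) (Φ (T (Φ.symm X))))
    exact fderiv_fderiv_symm (a := fun X => Φ (T.symm (Φ.symm X)))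
      (b := fun X => Φ (T (Φ.symm X))) (h4.differentiableAt hr) (h3.differentiableAt hr) h5 v
  image := by
    obtain ⟨N, hN, hNo, hpN⟩ := eventually_nhds_iff.1 h.comm
    -- The target neighbourhood is shrunk to `N`, so that the preimage point found there is one at
    -- which the normal form holds.
    obtain ⟨V, hVo, hpV, -, hV⟩ := hinv (U ∩ N) (hU.inter hNo) ⟨hpU, hpN⟩ Set.inter_subset_left
    have hV' : ∀ᶠ q in 𝓝 p, q ∈ V := hVo.mem_nhds hpV
    have ev := h.tendsto_φ_symm.eventually (hV'.and h.eventually_eq)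
    filter_upwards [ev, h.eventually_mem_target] with x h1 h2
    obtain ⟨q', hq', hfq'⟩ := hV ⟨_, ⟨_, h1.1, rfl⟩, rfl⟩
    refine ⟨φ q', ?_⟩
    rw [← hN q' hq'.2, hfq', h1.2, φ.right_inv h2]

theorem fderiv_chartMap (h : IsFoldChart r c f p φ Φ) (hr : r ≠ 0) (hT : T (f p) = f p)
    (hL : ∀ x, T x = f p + L (x - f p)) (v : E3) :
    fderiv ℝ Φ.symm 0 (fderiv ℝ (fun X => Φ (T (Φ.symm X))) 0 v) = L (fderiv ℝ Φ.symm 0 v) := by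
  have h1 : HasFDerivAt Φ.symm (fderiv ℝ Φ.symm 0) 0 :=
    (h.smooth_Φ_symm.contDiffAt.differentiableAt hr).hasFDerivAt
  have h2 := hasFDerivAt_isometry hL (Φ.symm 0)
  have h3 : HasFDerivAt Φ (fderiv ℝ Φ (f p)) (T (Φ.symm 0)) := by
    rw [h.symm_zero', hT]
    exact (h.smooth_Φ.contDiffAt.differentiableAt hr).hasFDerivAt
  have h4 : fderiv ℝ (fun X => Φ (T (Φ.symm X))) 0 v =
      fderiv ℝ Φ (f p) (L (fderiv ℝ Φ.symm 0 v)) :=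
    DFunLike.congr_fun (h3.comp 0 (h2.comp 0 h1)).fderiv v
  rw [h4, h.fderiv_symm_fderiv_Φ hr]

/-- The lift of a symmetry of the image germ, with the linear part of the symmetry in
an adapted frame. -/
theorem exists_lift (h : IsFoldChart r c f p φ Φ) (hr : r = ∞ ∨ r = ω) {U : Set (ℝ × ℝ)}
    (hU : IsOpen U) (hpU : p ∈ U) (hT : T (f p) = f p) (hL : ∀ x, T x = f p + L (x - f p))
    (hinv : PreservesImageGerm T f U p) :
    ∃ (ψ : ℝ × ℝ → ℝ × ℝ) (ε δ τ s : ℝ) (n : E3), SmoothNear r ψ p ∧ ψ p = p ∧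
      (∀ᶠ q in 𝓝 p, f (ψ q) = T (f q)) ∧
      (∀ᶠ q in 𝓝 p, (φ q).2 = 0 → (φ (ψ q)).2 = 0) ∧
      fderiv ℝ ψ p = (fderiv ℝ φ.symm 0).comp
        (((ε • ContinuousLinearMap.fst ℝ ℝ ℝ).prod (τ • ContinuousLinearMap.snd ℝ ℝ ℝ)).comp
          (fderiv ℝ φ p)) ∧
      IsEigenframe L (h.basisVec 2) (h.basisVec 0 - s • h.basisVec 2) n ε δ ∧
      (c = (fun _ => 1) → τ = δ) ∧ (c = id → τ = ε * δ) := by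
  have hr0 : r ≠ 0 := by rcases hr with rfl | rfl <;> simp
  have hS := h.isChartSymmetry hr0 hU hpU hT hL hinv
  obtain ⟨ψ, ε, τ, h1, h2, h3, h4, h5, h6, h7, h8, h9, h10, h11, h12⟩ := hS.exists_lift h.coeff hr
  set S := fun X => Φ (T (Φ.symm X)) with hSdef
  have hA := h.fderiv_chartMap hr0 hT hL
  have hA' : ∀ i, L (h.basisVec i) = fderiv ℝ Φ.symm 0 (fderiv ℝ S 0 (stdVec i)) :=
    fun i => (hA _).symm
  have hbasis : ∀ v : E3, v = v 0 • stdVec 0 + v 1 • stdVec 1 + v 2 • stdVec 2 := fun v => by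
    apply E3.ext' <;> simp
  have hmap : ∀ v : E3, fderiv ℝ Φ.symm 0 v =
      v 0 • h.basisVec 0 + v 1 • h.basisVec 1 + v 2 • h.basisVec 2 := fun v => by
    conv_lhs => rw [hbasis v]
    simp only [map_add, map_smul, basisVec]
  have f2 : L (h.basisVec 2) = ε • h.basisVec 2 := by
    rw [hA', h8, map_smul]; rfl
  have f0 : L (h.basisVec 0) =
      τ ^ 2 • h.basisVec 0 + (fderiv ℝ S 0 (stdVec 0) 2) • h.basisVec 2 := by
    rw [hA', hmap, h9, h10, zero_smul, add_zero]
  have f1 : L (h.basisVec 1) = (fderiv ℝ S 0 (stdVec 1) 0) • h.basisVec 0 +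
      (fderiv ℝ S 0 (stdVec 1) 1) • h.basisVec 1 +
      (fderiv ℝ S 0 (stdVec 1) 2) • h.basisVec 2 := by
    rw [hA', hmap]
  obtain ⟨hτ, s, n, hframe⟩ := exists_isEigenframe L (fun a b d habd => by
      have e1 : fderiv ℝ Φ.symm 0 (a • stdVec 0 + b • stdVec 1 + d • stdVec 2) = 0 := by
        rw [map_add, map_add, map_smul, map_smul, map_smul]; exact habd
      have e2 := h.fderiv_Φ_fderiv_symm hr0 (a • stdVec 0 + b • stdVec 1 + d • stdVec 2)
      rw [e1, map_zero] at e2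
      have e3 := fun i => congrArg (fun X : E3 => X i) e2.symm
      exact ⟨by simpa using e3 0, by simpa using e3 1, by simpa using e3 2⟩)
    (fun v => ⟨_, _, _, (h.fderiv_symm_fderiv_Φ hr0 v).symm.trans (hmap _)⟩) f2 f0 f1
  have hψφ : Tendsto (fun q => ψ (φ q)) (𝓝 p) (𝓝 0) := by
    have : Tendsto ψ (𝓝 0) (𝓝 0) := by simpa [h2] using h1.contDiffAt.continuousAt.tendsto
    exact this.comp h.tendsto_φ
  refine ⟨fun q => φ.symm (ψ (φ q)), ε, _, τ, s, n, ?_, ?_, ?_, ?_, ?_, hframe, ?_, ?_⟩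
  · refine h.smooth_φ_symm.comp_of_eq (h1.comp_of_eq h.smooth_φ h.apply_eq) ?_
    rw [h.apply_eq, h2]
  · simp only [h.apply_eq, h2, h.symm_zero]
  · have hc1 : ∀ᶠ x in 𝓝 (0 : ℝ × ℝ), f (φ.symm x) = Φ.symm (foldedMap c x) := by
      filter_upwards [h.tendsto_φ_symm.eventually h.eventually_eq, h.eventually_mem_target]
        with x e1 e2
      rw [e1, φ.right_inv e2]
    have hTf : Tendsto (fun q => T (f q)) (𝓝 p) (𝓝 (f p)) := by
      have := (T.continuous.tendsto (f p)).comp h.tendsto_f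
      rwa [hT] at this
    filter_upwards [hψφ.eventually hc1, h.tendsto_φ.eventually h3, h.eventually_eq,
      hTf.eventually h.eventually_mem_source'] with q e1 e2 e3 e4
    rw [e1, e2]
    simp only [← e3]
    rw [Φ.left_inv e4]
  · filter_upwards [hψφ.eventually h.eventually_mem_target] with q e1 e2
    rw [φ.right_inv e1, ← Prod.mk.eta (p := φ q), e2, h4]
  · have d1 : HasFDerivAt φ (fderiv ℝ φ p) p :=
      (h.smooth_φ.contDiffAt.differentiableAt hr0).hasFDerivAt
    have d2 : HasFDerivAt φ.symm (fderiv ℝ φ.symm 0) (ψ (φ p)) := by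
      rw [h.apply_eq, h2]
      exact (h.smooth_φ_symm.contDiffAt.differentiableAt hr0).hasFDerivAt
    rw [← h.apply_eq] at h7
    exact (d2.comp p (h7.comp p d1)).fderiv
  -- Since `τ ^ 2 = 1` and `ε ^ 2 = 1`, the relations `δ = τ³` and `δ = ε τ³` become `τ = δ` and `τ
  -- = ε δ`.
  · intro hc
    rw [h11 hc, pow_succ, hτ, one_mul]
  · intro hc
    rw [h12 hc, pow_succ, hτ, one_mul, ← mul_assoc, ← sq, hframe.sq_ε, one_mul]

end Symmetry

end IsFoldChart

/-! ### Invariant neighbourhoods, the singular curve and curvature -/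

/-- A germ of a continuous involution has arbitrarily small connected invariant open
neighbourhoods of its fixed point. -/
theorem exists_invariant_nhds {ψ : ℝ × ℝ → ℝ × ℝ} {p : ℝ × ℝ} (hc : ∀ᶠ q in 𝓝 p, ContinuousAt ψ q)
    (hp : ψ p = p) (hψ : ∀ᶠ q in 𝓝 p, ψ (ψ q) = q) {P : ℝ × ℝ → Prop} (hP : ∀ᶠ q in 𝓝 p, P q) :
    ∃ W : Set (ℝ × ℝ), IsOpen W ∧ IsConnected W ∧ p ∈ W ∧ Set.MapsTo ψ W W ∧
      (∀ q ∈ W, ψ (ψ q) = q) ∧ ∀ q ∈ W, P q := by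
  obtain ⟨N, hN, hNo, hpN⟩ := eventually_nhds_iff.1 (hc.and (hψ.and hP))
  have hcN : ContinuousOn ψ N := fun q hq => (hN q hq).1.continuousWithinAt
  have ht : Tendsto ψ (𝓝 p) (𝓝 p) := by simpa [hp] using hc.self_of_nhds.tendsto
  have hN' : ∀ᶠ q in 𝓝 p, q ∈ N := hNo.mem_nhds hpN
  obtain ⟨ε, hε, hball⟩ := Metric.eventually_nhds_iff_ball.1 (hN'.and (ht.eventually hN'))
  set B := Metric.ball p ε
  -- As `ψ` is its own inverse on `N`, the image of the ball is a relative preimage, hence open. The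
  -- neighbourhood is `B ∪ ψ '' B`, connected because both pieces contain `p`.
  have himage : ψ '' B = N ∩ ψ ⁻¹' B := by
    ext x
    constructor
    · rintro ⟨q, hq, rfl⟩
      refine ⟨(hball q hq).2, ?_⟩
      rw [Set.mem_preimage, (hN q (hball q hq).1).2.1]
      exact hq
    · rintro ⟨hx, hxB⟩
      exact ⟨ψ x, hxB, (hN x hx).2.1⟩
  have hpB : p ∈ B := Metric.mem_ball_self hε
  have hWN : B ∪ ψ '' B ⊆ N := by
    rintro x (hx | ⟨q, hq, rfl⟩)
    · exact (hball x hx).1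
    · exact (hball q hq).2
  refine ⟨B ∪ ψ '' B, ?_, ⟨⟨p, .inl hpB⟩, ?_⟩, .inl hpB, ?_, fun q hq => (hN q (hWN hq)).2.1,
    fun q hq => (hN q (hWN hq)).2.2⟩
  · rw [himage]
    exact Metric.isOpen_ball.union (hcN.isOpen_inter_preimage hNo Metric.isOpen_ball)
  · have hB : IsPreconnected B := (convex_ball p ε).isPreconnected
    exact hB.union p hpB ⟨p, hpB, hp⟩ (hB.image ψ (hcN.mono fun q hq => (hball q hq).1))
  · rintro x (hx | ⟨q, hq, rfl⟩)
    · exact .inr ⟨x, hx, rfl⟩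
    · left
      rw [(hN q (hball q hq).1).2.1]
      exact hq

/-- A `C^r`-function of one variable with nonzero derivative has a local `C^r`-inverse. -/
theorem SmoothNear.exists_inverse {r : WithTop ℕ∞} (hr : 1 ≤ r) {s : ℝ → ℝ}
    (hs : SmoothNear r s 0) (hs0 : s 0 = 0) {s' : ℝ} (hd : HasDerivAt s s' 0) (hs' : s' ≠ 0) :
    ∃ i : ℝ → ℝ, SmoothNear r i 0 ∧ i 0 = 0 ∧ HasDerivAt i s'⁻¹ 0 ∧ ∀ᶠ y in 𝓝 0, s (i y) = y := by
  have hr0 : r ≠ 0 := by rintro rfl; simp at hr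
  have hstrict : HasStrictDerivAt s s' 0 := by
    have := (hs.contDiffAt.hasStrictDerivAt hr0)
    rwa [hd.deriv] at this
  have hF := hstrict.hasStrictFDerivAt_equiv hs'
  let e := hF.toOpenPartialHomeomorph s
  have he : (e : ℝ → ℝ) = s := hF.toOpenPartialHomeomorph_coe
  have h0 : (0 : ℝ) ∈ e.source := hF.mem_toOpenPartialHomeomorph_source
  have hsymm0 : e.symm 0 = 0 := by
    have := e.left_inv h0
    rwa [he, hs0] at this
  have ht0 : (0 : ℝ) ∈ e.target := by
    have := e.map_source h0
    rwa [he, hs0] at this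
  have htend : Tendsto e.symm (𝓝 0) (𝓝 0) := by
    simpa [hsymm0] using (e.continuousAt_symm ht0).tendsto
  have hne : ∀ᶠ t in 𝓝 (0 : ℝ), deriv s t ≠ 0 := by
    have : ContinuousAt (deriv s) 0 :=
      ((hs.contDiffAt.of_le hr).fderiv_right (m := 0) (by simp)).continuousAt.clm_apply
        continuousAt_const
    exact this.eventually_ne (by rwa [hd.deriv])
  have hsm : SmoothNear r e.symm 0 := by
    filter_upwards [htend.eventually (hs.and hne), e.open_target.mem_nhds ht0] with y h1 h2
    have h3 : HasDerivAt e (deriv s (e.symm y)) (e.symm y) := by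
      rw [he]; exact (h1.1.differentiableAt hr0).hasDerivAt
    exact e.contDiffAt_symm_deriv h1.2 h2 h3 (by rw [he]; exact h1.1)
  refine ⟨e.symm, hsm, hsymm0, ?_, ?_⟩
  · have h3 : HasDerivAt e s' (e.symm 0) := by rw [he, hsymm0]; exact hd
    exact e.hasDerivAt_symm ht0 hs' h3
  · filter_upwards [e.open_target.mem_nhds ht0] with y hy
    have := e.right_inv hy
    rwa [he] at this

/-- By the second derivative test `h` has a constant weak sign near `0`. Then `h (θ t)` and `h t`
have the same weak sign and sum to zero, so `h` vanishes near `0`, contradicting the second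
derivative. -/
theorem not_anti_invariant {h θ : ℝ → ℝ} (hc : ContinuousAt h 0) (h1 : deriv h 0 = 0)
    (h2 : deriv (deriv h) 0 ≠ 0) (hθ : Tendsto θ (𝓝 0) (𝓝 0)) (hθ0 : θ 0 = 0) :
    ¬ ∀ᶠ t in 𝓝 0, h (θ t) = -h t := by
  intro hinv
  have h0 : h 0 = 0 := by
    have := hinv.self_of_nhds
    rw [hθ0] at this
    linarith
  suffices hz : h =ᶠ[𝓝 0] fun _ => 0 by
    have h3 : deriv h =ᶠ[𝓝 0] fun _ => 0 := by
      filter_upwards [hz.eventuallyEq_nhds] with t ht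
      simp [ht.deriv_eq]
    exact h2 (by simp [h3.deriv_eq])
  rcases lt_or_gt_of_ne h2 with hneg | hpos
  · have hmax : ∀ᶠ t in 𝓝 0, h t ≤ 0 := by
      filter_upwards [isLocalMax_of_deriv_deriv_neg hneg h1 hc] with t ht
      rwa [h0] at ht
    filter_upwards [hmax, hθ.eventually hmax, hinv] with t e1 e2 e3
    linarith
  · have hmin : ∀ᶠ t in 𝓝 0, 0 ≤ h t := by
      filter_upwards [isLocalMin_of_deriv_deriv_pos hpos h1 hc] with t ht
      rwa [h0] at ht
    filter_upwards [hmin, hθ.eventually hmin, hinv] with t e1 e2 e3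
    linarith

theorem IsUnitNormalNear.norm_eq {r : WithTop ℕ∞} {f ν : ℝ × ℝ → E3} {p : ℝ × ℝ}
    (hν : IsUnitNormalNear r f ν p) : ‖ν p‖ = 1 := hν.self_of_nhds.2.1

theorem deriv_deriv_inner {F : ℝ → E3} (hF : ContDiffAt ℝ 2 F 0) (x₀ v : E3) :
    ContinuousAt (fun t => ⟪F t - x₀, v⟫_ℝ) 0 ∧
    deriv (fun t => ⟪F t - x₀, v⟫_ℝ) 0 = ⟪deriv F 0, v⟫_ℝ ∧
    deriv (deriv fun t => ⟪F t - x₀, v⟫_ℝ) 0 = ⟪iteratedDeriv 2 F 0, v⟫_ℝ := by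
  have h1 : deriv (fun t => ⟪F t - x₀, v⟫_ℝ) =ᶠ[𝓝 0] fun t => ⟪deriv F t, v⟫_ℝ := by
    filter_upwards [hF.eventually (by simp)] with t ht
    have h2 := ((ht.differentiableAt two_ne_zero).hasDerivAt.sub_const x₀).inner ℝ
      (hasDerivAt_const t v)
    simpa using h2.deriv
  have h3 : HasDerivAt (deriv F) (iteratedDeriv 2 F 0) 0 := by
    have h4 : DifferentiableAt ℝ (fun t => fderiv ℝ F t 1) 0 :=
      ((hF.fderiv_right (m := 1) (by norm_num)).differentiableAt one_ne_zero).clm_apply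
        (differentiableAt_const _)
    have h5 : iteratedDeriv 2 F 0 = deriv (deriv F) 0 := by
      rw [iteratedDeriv_succ, iteratedDeriv_one]
    rw [h5]
    exact h4.hasDerivAt
  refine ⟨?_, h1.self_of_nhds, ?_⟩
  · exact (hF.continuousAt.sub continuousAt_const).inner continuousAt_const
  · rw [h1.deriv_eq]
    simpa using (h3.inner ℝ (hasDerivAt_const 0 v)).deriv

theorem IsEigenframe.inner_map_n {L : E3 ≃ₗᵢ[ℝ] E3} {t e n : E3} {ε δ : ℝ}
    (h : IsEigenframe L t e n ε δ) (x : E3) : ⟪L x, n⟫_ℝ = δ * ⟪x, n⟫_ℝ := by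
  have h1 : n = δ • L n := by rw [h.map_n, smul_smul, ← sq, h.sq_δ, one_smul]
  conv_lhs => rw [h1]
  rw [real_inner_smul_right, L.inner_map_map]

theorem IsEigenframe.inner_map_e {L : E3 ≃ₗᵢ[ℝ] E3} {t e n : E3} {ε δ : ℝ}
    (h : IsEigenframe L t e n ε δ) (x : E3) : ⟪L x, e⟫_ℝ = ⟪x, e⟫_ℝ := by
  conv_lhs => rw [← h.map_e]
  rw [L.inner_map_map]

theorem IsEigenframe.inner_map_t {L : E3 ≃ₗᵢ[ℝ] E3} {t e n : E3} {ε δ : ℝ}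
    (h : IsEigenframe L t e n ε δ) (x : E3) : ⟪L x, t⟫_ℝ = ε * ⟪x, t⟫_ℝ := by
  have h1 : t = ε • L t := by rw [h.map_t, smul_smul, ← sq, h.sq_ε, one_smul]
  conv_lhs => rw [h1]
  rw [real_inner_smul_right, L.inner_map_map]

namespace IsFoldChart

variable {r : WithTop ℕ∞} {c : ℝ → ℝ} {f : ℝ × ℝ → E3} {p : ℝ × ℝ}
  {φ : OpenPartialHomeomorph (ℝ × ℝ) (ℝ × ℝ)} {Φ : OpenPartialHomeomorph E3 E3}

/-- The derivative is conjugate to `diag(ε, τ)` by the derivative of the source chart. -/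
theorem det_fderiv (h : IsFoldChart r c f p φ Φ) (hr : r ≠ 0) {ψ : ℝ × ℝ → ℝ × ℝ} {ε τ : ℝ}
    (hψ : fderiv ℝ ψ p = (fderiv ℝ φ.symm 0).comp
      (((ε • ContinuousLinearMap.fst ℝ ℝ ℝ).prod (τ • ContinuousLinearMap.snd ℝ ℝ ℝ)).comp
        (fderiv ℝ φ p))) : (fderiv ℝ ψ p).det = ε * τ := by
  have h1 : (fderiv ℝ φ.symm 0).comp (fderiv ℝ φ p) = ContinuousLinearMap.id ℝ (ℝ × ℝ) := by
    ext1
    all_goals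
      ext1
      have := (h.fderiv_symm_fderiv_φ hr).self_of_nhds
      rw [h.apply_eq] at this
      simp [this]
  have h2 : LinearMap.det ((fderiv ℝ φ.symm 0 : ℝ × ℝ →L[ℝ] ℝ × ℝ) : ℝ × ℝ →ₗ[ℝ] ℝ × ℝ) *
      LinearMap.det ((fderiv ℝ φ p : ℝ × ℝ →L[ℝ] ℝ × ℝ) : ℝ × ℝ →ₗ[ℝ] ℝ × ℝ) = 1 := by
    rw [← LinearMap.det_comp, ← ContinuousLinearMap.toLinearMap_comp, h1]
    exact LinearMap.det_id
  have h3 : LinearMap.det (((ε • ContinuousLinearMap.fst ℝ ℝ ℝ).prod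
      (τ • ContinuousLinearMap.snd ℝ ℝ ℝ) : ℝ × ℝ →L[ℝ] ℝ × ℝ) : ℝ × ℝ →ₗ[ℝ] ℝ × ℝ) = ε * τ := by
    have : (((ε • ContinuousLinearMap.fst ℝ ℝ ℝ).prod
      (τ • ContinuousLinearMap.snd ℝ ℝ ℝ) : ℝ × ℝ →L[ℝ] ℝ × ℝ) : ℝ × ℝ →ₗ[ℝ] ℝ × ℝ) =
        (ε • LinearMap.id).prodMap (τ • LinearMap.id) := rfl
    rw [this, LinearMap.det_prodMap, LinearMap.det_smul, LinearMap.det_smul]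
    simp
  rw [hψ, ContinuousLinearMap.det, ContinuousLinearMap.toLinearMap_comp,
    ContinuousLinearMap.toLinearMap_comp, LinearMap.det_comp, LinearMap.det_comp, h3]
  linear_combination (ε * τ) * h2

/-- The change of parameter that a lift induces on the singular curve. -/
theorem exists_reparam (h : IsFoldChart r c f p φ Φ) (hr : 1 ≤ r) {U : Set (ℝ × ℝ)}
    {γ : ℝ → ℝ × ℝ} (hγ : IsSingularCurve r f U p γ) {ψ : ℝ × ℝ → ℝ × ℝ} {ε τ : ℝ}
    (hψs : SmoothNear r ψ p) (hψp : ψ p = p)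
    (hax : ∀ᶠ q in 𝓝 p, (φ q).2 = 0 → (φ (ψ q)).2 = 0)
    (hψ : fderiv ℝ ψ p = (fderiv ℝ φ.symm 0).comp
      (((ε • ContinuousLinearMap.fst ℝ ℝ ℝ).prod (τ • ContinuousLinearMap.snd ℝ ℝ ℝ)).comp
        (fderiv ℝ φ p))) :
    ∃ θ : ℝ → ℝ, θ 0 = 0 ∧ SmoothNear r θ 0 ∧ HasDerivAt θ ε 0 ∧
      ∀ᶠ t in 𝓝 0, ψ (γ t) = γ (θ t) := by
  have hr0 : r ≠ 0 := by rintro rfl; simp at hr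
  obtain ⟨hγ0, hγs, hγ', hmap⟩ := hγ
  have hγs : SmoothNear r γ 0 := hγs
  have hγt : Tendsto γ (𝓝 0) (𝓝[singularSet f U] p) := hmap.le
  have hγt' : Tendsto γ (𝓝 0) (𝓝 p) := hγt.mono_right nhdsWithin_le_nhds
  have hsing : ∀ᶠ t in 𝓝 0, (φ (γ t)).2 = 0 := by
    filter_upwards [hγt.eventually eventually_mem_nhdsWithin,
      hγt'.eventually (h.snd_eq_zero_of_singular hr0)] with t h1 h2 using h2 h1.2
  have hφγ : SmoothNear r (fun t => φ (γ t)) 0 := h.smooth_φ.comp_of_eq hγs hγ0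
  have dγ : HasDerivAt γ (deriv γ 0) 0 := (hγs.contDiffAt.differentiableAt hr0).hasDerivAt
  have dφ : HasFDerivAt φ (fderiv ℝ φ p) p :=
    (h.smooth_φ.contDiffAt.differentiableAt hr0).hasFDerivAt
  have dφγ : HasDerivAt (fun t => φ (γ t)) (fderiv ℝ φ p (deriv γ 0)) 0 :=
    dφ.comp_hasDerivAt_of_eq 0 dγ hγ0.symm
  set w := fderiv ℝ φ p (deriv γ 0) with hw
  have d1 : HasDerivAt (fun t => (φ (γ t)).1) w.1 0 :=
    (ContinuousLinearMap.fst ℝ ℝ ℝ).hasFDerivAt.comp_hasDerivAt (0 : ℝ) dφγ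
  have d2 : HasDerivAt (fun t => (φ (γ t)).2) w.2 0 :=
    (ContinuousLinearMap.snd ℝ ℝ ℝ).hasFDerivAt.comp_hasDerivAt (0 : ℝ) dφγ
  -- In the chart the singular curve runs inside `v = 0`, so its nonzero velocity is along `u`, and
  -- `u` serves as a parameter of the curve.
  have hw2 : w.2 = 0 := by
    have h3 : HasDerivAt (fun _ : ℝ => (0 : ℝ)) w.2 0 :=
      d2.congr_of_eventuallyEq (hsing.mono fun t ht => ht.symm)
    exact h3.unique (hasDerivAt_const _ _)
  have hw1 : w.1 ≠ 0 := by
    intro h0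
    have h3 : w = 0 := Prod.ext h0 hw2
    have h4 := (h.fderiv_symm_fderiv_φ hr0).self_of_nhds (deriv γ 0)
    rw [← hw, h3, map_zero] at h4
    exact hγ' h4.symm
  have hs : SmoothNear r (fun t => (φ (γ t)).1) 0 := hφγ.mono fun t ht => ht.fst
  obtain ⟨i, hi, hi0, hi', hsi⟩ := hs.exists_inverse hr (by rw [hγ0, h.apply_eq]; rfl) d1 hw1
  have hψγ : SmoothNear r (fun t => φ (ψ (γ t))) 0 :=
    h.smooth_φ.comp_of_eq (hψs.comp_of_eq hγs hγ0) (by rw [hγ0, hψp])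
  have z : (φ (ψ (γ 0))).1 = 0 := by rw [hγ0, hψp, h.apply_eq]; rfl
  have hθs : SmoothNear r (fun t => i (φ (ψ (γ t))).1) 0 :=
    hi.comp_of_eq (hψγ.mono fun t ht => ht.fst) z
  have hθ0 : i (φ (ψ (γ 0))).1 = 0 := by rw [z, hi0]
  -- `θ` reads off the `u`-coordinate of the image point and inverts the coordinate along `γ`. The
  -- two points to be compared share this coordinate and both have `v = 0`.
  refine ⟨fun t => i (φ (ψ (γ t))).1, hθ0, hθs, ?_, ?_⟩
  · have e1 : HasFDerivAt ψ (fderiv ℝ ψ p) p := (hψs.contDiffAt.differentiableAt hr0).hasFDerivAt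
    have e2 := e1.comp_hasDerivAt_of_eq 0 dγ hγ0.symm
    have e3 : HasDerivAt (fun t => φ (ψ (γ t))) (fderiv ℝ φ p (fderiv ℝ ψ p (deriv γ 0))) 0 :=
      dφ.comp_hasDerivAt_of_eq 0 e2 (by simp [hγ0, hψp])
    rw [hψ] at e3
    simp only [ContinuousLinearMap.comp_apply, h.fderiv_φ_fderiv_symm hr0, ← hw] at e3
    have e4 : HasDerivAt (fun t => (φ (ψ (γ t))).1) (ε * w.1) 0 :=
      (ContinuousLinearMap.fst ℝ ℝ ℝ).hasFDerivAt.comp_hasDerivAt (0 : ℝ) e3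
    have e5 := hi'.comp_of_eq 0 e4 z.symm
    rwa [show w.1⁻¹ * (ε * w.1) = ε by field_simp] at e5
  · have t1 : Tendsto (fun t => (φ (ψ (γ t))).1) (𝓝 0) (𝓝 0) := by
      have := (hψγ.contDiffAt.continuousAt.fst).tendsto
      rwa [z] at this
    have t2 : Tendsto (fun t => i (φ (ψ (γ t))).1) (𝓝 0) (𝓝 0) := by
      have := hθs.contDiffAt.continuousAt.tendsto
      rwa [hθ0] at this
    have t3 : Tendsto (fun t => ψ (γ t)) (𝓝 0) (𝓝 p) := by
      have := hψs.contDiffAt.continuousAt.tendsto.comp hγt'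
      rwa [hψp] at this
    filter_upwards [hsing, hγt'.eventually hax, t1.eventually hsi, t2.eventually hsing,
      t3.eventually h.eventually_mem_source,
      t2.eventually (hγt'.eventually h.eventually_mem_source)]
      with t h1 h2 h3 h4 h5 h6
    refine φ.injOn h5 h6 (Prod.ext h3.symm ?_)
    rw [h2 h1, h4]

end IsFoldChart

/-- For an isometry other than the identity, the eigenvalues of an eigenframe are not all `1`. -/
theorem IsEigenframe.not_one_and_one {L : E3 ≃ₗᵢ[ℝ] E3} {t e n : E3} {ε δ : ℝ}
    (h : IsEigenframe L t e n ε δ) {T : E3 ≃ᵢ E3} {x₀ : E3} (hL : ∀ x, T x = x₀ + L (x - x₀))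
    (hT : T ≠ IsometryEquiv.refl E3) : ¬ (ε = 1 ∧ δ = 1) := by
  rintro ⟨h1, h2⟩
  refine hT (IsometryEquiv.ext fun x => ?_)
  rw [hL, h.map_eq_self h1 h2, add_sub_cancel]
  rfl

/-! ### The theorem in a fixed normal form chart -/

namespace IsFoldChart

variable {r : WithTop ℕ∞} {c : ℝ → ℝ} {f : ℝ × ℝ → E3} {p : ℝ × ℝ}
  {φ : OpenPartialHomeomorph (ℝ × ℝ) (ℝ × ℝ)} {Φ : OpenPartialHomeomorph E3 E3}

/-- Along the preimage of the self-intersection curve of a cuspidal cross cap, `f` is determined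
by its component in a direction that is not orthogonal to the tangent of that curve. -/
theorem eq_of_inner_eq (h : IsFoldChart r id f p φ Φ) (hr : r ≠ 0) {e : E3}
    (he : ⟪h.basisVec 0, e⟫_ℝ ≠ 0) : ∃ N ∈ 𝓝 p, ∀ q ∈ N, ∀ q' ∈ N, (φ q).1 = 0 → (φ q').1 = 0 →
      ⟪f q - f p, e⟫_ℝ = ⟪f q' - f p, e⟫_ℝ → f q = f q' := by
  -- Over `u = 0` the map is `Φ.symm (v² • stdVec 0)`, a function of `v²` alone. `η` is its
  -- `e`-component as a function of `v²`; its derivative at `0` is nonzero, so it is locally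
  -- injective.
  let η : ℝ → ℝ := fun x => ⟪Φ.symm (x • stdVec 0) - f p, e⟫_ℝ
  have d0 : HasStrictDerivAt (fun x : ℝ => x • stdVec 0) (stdVec 0) 0 := by
    simpa using (hasStrictDerivAt_id (0 : ℝ)).smul_const (stdVec 0)
  have d1 : HasStrictFDerivAt Φ.symm (fderiv ℝ Φ.symm 0) ((0 : ℝ) • stdVec 0) := by
    rw [zero_smul]
    exact h.smooth_Φ_symm.contDiffAt.hasStrictFDerivAt hr
  have d2 : HasStrictDerivAt (fun x : ℝ => Φ.symm (x • stdVec 0) - f p) (h.basisVec 0) 0 :=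
    (d1.comp_hasStrictDerivAt 0 d0).sub_const _
  have d3 : HasStrictDerivAt η ⟪h.basisVec 0, e⟫_ℝ 0 := by
    have := ((innerSL ℝ e).hasStrictFDerivAt
      (x := Φ.symm ((0 : ℝ) • stdVec 0) - f p)).comp_hasStrictDerivAt 0 d2
    rw [real_inner_comm]
    refine this.congr_of_eventuallyEq (Eventually.of_forall fun x => ?_)
    simp only [Function.comp_apply, innerSL_apply_apply, η]
    exact real_inner_comm _ _
  have hli := (d3.hasStrictFDerivAt_equiv he).eventually_left_inverse
  have hsq : Tendsto (fun q => (φ q).2 ^ 2) (𝓝 p) (𝓝 0) := by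
    have := ((continuous_snd.tendsto 0).comp h.tendsto_φ).pow 2
    simpa using this
  refine ⟨_, h.eventually_eq.and (hsq.eventually hli), fun q hq q' hq' h0 h0' hqq' => ?_⟩
  have e1 : ∀ q, f q = Φ.symm (foldedMap id (φ q)) → (φ q).1 = 0 →
      f q = Φ.symm ((φ q).2 ^ 2 • stdVec 0) := fun q hq hq0 => by
    rw [hq, foldedMap_eq, hq0]
    simp
  rw [e1 q hq.1 h0, e1 q' hq'.1 h0'] at hqq' ⊢
  have e2 : (φ q).2 ^ 2 = (φ q').2 ^ 2 := by
    rw [← hq.2, ← hq'.2]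
    exact congrArg _ hqq'
  rw [e2]

section Symmetry

variable {T : E3 ≃ᵢ E3} {L : E3 ≃ₗᵢ[ℝ] E3} {ε δ s : ℝ} {n : E3} {ν : ℝ × ℝ → E3}

/-- The unit normal is orthogonal to both `t` and `e`, so it spans the third eigenline and can
replace the auxiliary vector `n`. -/
theorem isEigenframe_normal (h : IsFoldChart r c f p φ Φ) (hr : 1 ≤ r)
    (hframe : IsEigenframe L (h.basisVec 2) (h.basisVec 0 - s • h.basisVec 2) n ε δ)
    (hν : IsUnitNormalNear r f ν p) :
    IsEigenframe L (h.basisVec 2) (h.basisVec 0 - s • h.basisVec 2) (ν p) ε δ := by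
  have hr0 : r ≠ 0 := by rintro rfl; simp at hr
  have h2 : ⟪ν p, h.basisVec 2⟫_ℝ = 0 := by
    rw [real_inner_comm]; exact h.inner_basisVec_two hr0 hν
  have h0 : ⟪ν p, h.basisVec 0⟫_ℝ = 0 := by
    rw [real_inner_comm]; exact h.inner_basisVec_zero hr hν
  refine hframe.replace_n (fun h3 => ?_) h2 ?_
  · have := hν.norm_eq
    rw [h3, norm_zero] at this
    exact zero_ne_one this
  · rw [inner_sub_right, real_inner_smul_right, h0, h2, mul_zero, sub_zero]

theorem inner_basisVec_zero_ne_zero (h : IsFoldChart r c f p φ Φ)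
    (hframe : IsEigenframe L (h.basisVec 2) (h.basisVec 0 - s • h.basisVec 2) n ε δ) :
    ⟪h.basisVec 0, h.basisVec 0 - s • h.basisVec 2⟫_ℝ ≠ 0 := by
  have h1 : h.basisVec 0 = (h.basisVec 0 - s • h.basisVec 2) + s • h.basisVec 2 := by abel
  set e := h.basisVec 0 - s • h.basisVec 2
  rw [h1, inner_add_left, real_inner_smul_left, real_inner_comm e (h.basisVec 2),
    hframe.inner_e_t, mul_zero, add_zero]
  exact IsEigenframe.inner_self_ne_zero_of_ne_zero hframe.e_ne

/-- A symmetry of a surface with nonzero limiting normal curvature preserves the normal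
direction. -/
theorem δ_eq_one_of_limitingNormalCurvature_ne_zero (h : IsFoldChart r c f p φ Φ)
    (hr : 2 ≤ r) (hL : ∀ x, T x = f p + L (x - f p)) {t e : E3}
    (hframe : IsEigenframe L t e (ν p) ε δ) (hν : IsUnitNormalNear r f ν p)
    {U : Set (ℝ × ℝ)} {γ : ℝ → ℝ × ℝ} (hγ : IsSingularCurve r f U p γ) {ψ : ℝ × ℝ → ℝ × ℝ}
    (hψ : ∀ᶠ q in 𝓝 p, f (ψ q) = T (f q)) {θ : ℝ → ℝ} (hθ0 : θ 0 = 0)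
    (hθ : Tendsto θ (𝓝 0) (𝓝 0)) (hψγ : ∀ᶠ t in 𝓝 0, ψ (γ t) = γ (θ t))
    (hκ : limitingNormalCurvature f ν γ ≠ 0) : δ = 1 := by
  obtain ⟨hγ0, hγs, hγ', hmap⟩ := hγ
  have hr0 : r ≠ 0 := by rintro rfl; simp at hr
  have hγs : SmoothNear r γ 0 := hγs
  have hγt : Tendsto γ (𝓝 0) (𝓝 p) := hmap.le.trans nhdsWithin_le_nhds
  have hF : ContDiffAt ℝ 2 (f ∘ γ) 0 :=
    (h.smooth.comp_of_eq hγs hγ0).contDiffAt.of_le hr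
  obtain ⟨i1, i2, i3⟩ := deriv_deriv_inner hF (f p) (ν p)
  refine hframe.δ_eq.resolve_right fun hδ => ?_
  -- Applied to the height `⟪f (γ t) - f p, ν p⟫` over the limiting tangent plane: `T` negates it
  -- when `δ = -1`, and its second derivative is the numerator of the curvature.
  refine not_anti_invariant i1 ?_ ?_ hθ hθ0 ?_
  · have d1 : HasFDerivAt f (fderiv ℝ f p) p :=
      (h.smooth.contDiffAt.differentiableAt hr0).hasFDerivAt
    have d2 := d1.comp_hasDerivAt_of_eq 0
      (hγs.contDiffAt.differentiableAt hr0).hasDerivAt hγ0.symm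
    rw [i2, d2.deriv]
    exact hν.self_of_nhds.2.2 _
  · rw [i3]
    intro h0
    refine hκ ?_
    rw [limitingNormalCurvature, hγ0, h0, zero_div]
  · filter_upwards [hψγ, hγt.eventually hψ] with t h1 h2
    simp only [Function.comp_apply]
    rw [← h1, h2, hL, add_sub_cancel_left, hframe.inner_map_n, hδ, neg_one_mul]

/-- The main result for a map in a fixed normal form chart. -/
theorem exists_involution (h : IsFoldChart r c f p φ Φ) (hr : r = ∞ ∨ r = ω) {U : Set (ℝ × ℝ)}
    (hU : IsOpen U) (hpU : p ∈ U) (hTp : T (f p) = f p) (hT : T ≠ IsometryEquiv.refl E3)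
    (hinv : PreservesImageGerm T f U p) :
    ∃ (W : Set (ℝ × ℝ)) (ψ : ℝ × ℝ → ℝ × ℝ),
      IsOpen W ∧ IsConnected W ∧ p ∈ W ∧ W ⊆ U ∧ ψ p = p ∧ IsInvolutionOn r ψ W ∧
      (∀ q ∈ W, f (ψ q) = T (f q)) ∧
      (∀ ψ' : ℝ × ℝ → ℝ × ℝ, (∀ᶠ q in 𝓝 p, ContinuousAt ψ' q) → ψ' p = p →
        (∀ᶠ q in 𝓝 p, f (ψ' q) = T (f q)) → ψ' =ᶠ[𝓝 p] ψ) ∧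
      ∀ (ν : ℝ × ℝ → E3) (γ : ℝ → ℝ × ℝ),
        IsUnitNormalNear r f ν p → IsSingularCurve r f U p γ →
        (limitingNormalCurvature f ν γ ≠ 0 → T = reflectionIn (normalPlane f p)) ∧
        (T ≠ reflectionIn (limitingTangentPlane f ν p) → ReversesCurve r ψ γ) ∧
        (c = (fun _ => 1) →
          T ≠ reflectionIn (conormalLine f ν p) → ReversesOrientationOn ψ W) ∧
        (c = id →
          (T ≠ reflectionIn (limitingTangentPlane f ν p) →
            T ≠ reflectionIn (conormalLine f ν p) → PreservesOrientationOn ψ W) ∧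
          ∀ q ∈ selfIntersectionSet f W, T (f q) = f q ∧
            (T ≠ reflectionIn (limitingTangentPlane f ν p) → f q ∈ normalPlane f p)) := by
  have hr0 : r ≠ 0 := by rcases hr with rfl | rfl <;> simp
  have hr1 : 1 ≤ r := by rcases hr with rfl | rfl <;> simp
  have hr2 : 2 ≤ r := by
    rcases hr with rfl | rfl
    · exact WithTop.coe_le_coe.2 (le_top : (2 : ℕ∞) ≤ ⊤)
    · exact le_top
  obtain ⟨L, hL⟩ := exists_linearIsometryEquiv hTp
  obtain ⟨ψ, ε, δ, τ, s, n, hψs, hψp, hψf, hψax, hψd, hframe, hedge, hcross⟩ :=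
    h.exists_lift hr hU hpU hTp hL hinv
  have hψt : Tendsto ψ (𝓝 p) (𝓝 p) := by simpa [hψp] using hψs.contDiffAt.continuousAt.tendsto
  have hTT : ∀ x, T (T x) = x := fun x => by
    rw [hL, hL x, add_sub_cancel_left, hframe.map_map, add_sub_cancel]
  -- `ψ ∘ ψ` lifts `T ∘ T`, which is the identity, so rigidity applies.
  have hψψ : ∀ᶠ q in 𝓝 p, ψ (ψ q) = q := by
    refine h.eventually_eq_id ?_ (by rw [hψp, hψp]) ?_
    · filter_upwards [hψs, hψt.eventually hψs] with q h1 h2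
      exact ContinuousAt.comp (f := ψ) (g := ψ) h2.continuousAt h1.continuousAt
    · filter_upwards [hψf, hψt.eventually hψf] with q h1 h2
      rw [h2, h1, hTT]
  have hdet := h.det_fderiv hr0 hψd
  have hετ0 : ε * τ ≠ 0 := by
    have hε0 : ε ≠ 0 := fun h0 => by simpa [h0] using hframe.sq_ε
    have hδ0 : δ ≠ 0 := fun h0 => by simpa [h0] using hframe.sq_δ
    rcases h.coeff with hc | hc
    · rw [hedge hc]; exact mul_ne_zero hε0 hδ0
    · rw [hcross hc]; exact mul_ne_zero hε0 (mul_ne_zero hε0 hδ0)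
  -- Near `p` the determinant keeps the sign of `ε * τ`; the product form handles both signs at
  -- once, before the cases are separated.
  have hdetW : ∀ᶠ q in 𝓝 p, 0 < ε * τ * (fderiv ℝ ψ q).det := by
    have h1 : ContinuousAt (fun q => ε * τ * (fderiv ℝ ψ q).det) p :=
      continuousAt_const.mul (ContinuousLinearMap.continuous_det.continuousAt.comp
        ((hψs.contDiffAt.of_le hr1).fderiv_right (m := 0) (by simp)).continuousAt)
    refine h1.eventually (lt_mem_nhds ?_)
    simp only [hdet]
    exact mul_self_pos.2 hετ0
  have hself : ∃ N ∈ 𝓝 p, c = id → ∀ q ∈ N, ∀ q' ∈ N, (φ q).1 = 0 → (φ q').1 = 0 →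
      ⟪f q - f p, h.basisVec 0 - s • h.basisVec 2⟫_ℝ =
        ⟪f q' - f p, h.basisVec 0 - s • h.basisVec 2⟫_ℝ → f q = f q' := by
    rcases h.coeff with hc | hc
    · exact ⟨Set.univ, univ_mem, fun hc' => by
        have := congrFun (hc.symm.trans hc') 0
        simp at this⟩
    · subst hc
      obtain ⟨N, hN, hN'⟩ := h.eq_of_inner_eq hr0 (h.inner_basisVec_zero_ne_zero hframe)
      exact ⟨N, hN, fun _ => hN'⟩
  obtain ⟨N, hN, hNself⟩ := hself
  have hN : ∀ᶠ q in 𝓝 p, q ∈ N := hN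
  have hUp : ∀ᶠ q in 𝓝 p, q ∈ U := hU.mem_nhds hpU
  obtain ⟨W, hWo, hWc, hpW, hψW, hψψW, hW⟩ := exists_invariant_nhds hψs.eventually_continuousAt
    hψp hψψ (hψs.and (hψf.and (hdetW.and (hN.and (hUp.and (h.comm.and h.eventually_mem_source))))))
  refine ⟨W, ψ, hWo, hWc, hpW, fun q hq => (hW q hq).2.2.2.2.1, hψp,
    ⟨fun q hq => (hW q hq).1.contDiffWithinAt, hψW, hψψW⟩, fun q hq => (hW q hq).2.1, ?_, ?_⟩
  · intro ψ' hψ'c hψ'p hψ'f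
    have hψ't : Tendsto ψ' (𝓝 p) (𝓝 p) := by simpa [hψ'p] using hψ'c.self_of_nhds.tendsto
    -- `ψ ∘ ψ'` lifts the identity as well, so `ψ'` is inverse to the involution `ψ` and agrees with
    -- it.
    have h1 : ∀ᶠ q in 𝓝 p, ψ (ψ' q) = q := by
      refine h.eventually_eq_id ?_ (by rw [hψ'p, hψp]) ?_
      · filter_upwards [hψ'c, hψ't.eventually hψs] with q e1 e2
        exact ContinuousAt.comp (f := ψ') (g := ψ) e2.continuousAt e1
      · filter_upwards [hψ'f, hψ't.eventually hψf] with q e1 e2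
        rw [e2, e1, hTT]
    filter_upwards [h1, hψ't.eventually hψψ] with q e1 e2
    rw [← e2, e1]
  intro ν γ hν hγ
  have hfr := h.isEigenframe_normal hr1 hframe hν
  have htan := h.tangentDirection_eq hr0
  have hne := hfr.not_one_and_one hL hT
  have hR1 : ε = -1 → δ = 1 → T = reflectionIn (normalPlane f p) := fun h1 h2 => by
    have := hfr.eq_reflectionIn_of_neg_one hL h1 h2
    simpa only [normalPlane, htan] using this
  have hR0 : ε = 1 → T = reflectionIn (limitingTangentPlane f ν p) := fun h1 =>
    hfr.eq_reflectionIn_of_one hL h1 (hfr.δ_eq.resolve_left fun h2 => hne ⟨h1, h2⟩)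
  have hR2 : ε = -1 → δ = -1 → T = reflectionIn (conormalLine f ν p) := fun h1 h2 => by
    have := hfr.eq_reflectionIn_of_neg_one_neg_one hL h1 h2
    simpa only [conormalLine, htan] using this
  obtain ⟨θ, hθ0, hθs, hθd, hθγ⟩ := h.exists_reparam hr1 hγ hψs hψp hψax hψd
  refine ⟨fun hκ => ?_, fun hT0 => ?_, fun hc hT2 q hq => ?_,
    fun hc => ⟨fun hT0 hT2 q hq => ?_, ?_⟩⟩
  · have hθt : Tendsto θ (𝓝 0) (𝓝 0) := by simpa [hθ0] using hθd.continuousAt.tendsto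
    have hδ := h.δ_eq_one_of_limitingNormalCurvature_ne_zero hr2 hL hfr hν hγ hψf hθ0 hθt hθγ hκ
    exact hR1 (hfr.ε_eq.resolve_left fun hε => hne ⟨hε, hδ⟩) hδ
  · have hε := hfr.ε_eq.resolve_left fun hε => hT0 (hR0 hε)
    exact ⟨θ, hθ0, hθs, by rw [hθd.deriv, hε]; norm_num, hθγ⟩
  · have h1 := (hW q hq).2.2.1
    have h2 : ε * τ = -1 := by
      rw [hedge hc]
      rcases hfr.ε_eq with e1 | e1 <;> rcases hfr.δ_eq with e2 | e2
      · exact absurd ⟨e1, e2⟩ hne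
      · rw [e1, e2]; norm_num
      · rw [e1, e2]; norm_num
      · exact absurd (hR2 e1 e2) hT2
    rw [h2] at h1
    linarith
  · have h1 := (hW q hq).2.2.1
    -- Here `ε τ = ε² δ = δ`, and the excluded cases leave only `ε = -1`, `δ = 1`.
    have h2 : ε * τ = 1 := by
      have e1 := hfr.ε_eq.resolve_left fun hε => hT0 (hR0 hε)
      have e2 := hfr.δ_eq.resolve_right fun hδ => hT2 (hR2 e1 hδ)
      rw [hcross hc, e1, e2]; norm_num
    rwa [h2, one_mul] at h1
  · have haxis : ∀ q ∈ W, ∀ q' ∈ W, q' ≠ q → f q' = f q → (φ q).1 = 0 := by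
      intro q hq q' hq' hqq' hfq
      have e1 := (hW q hq).2.2.2.2.2
      have e2 := (hW q' hq').2.2.2.2.2
      have e3 : foldedMap c (φ q) = foldedMap c (φ q') := by rw [← e1.1, ← e2.1, hfq]
      obtain ⟨e4, e5⟩ := foldedMap_eq_iff e3
      rcases e5 with e5 | e5
      · exact absurd (φ.injOn e1.2 e2.2 (Prod.ext e4 e5)).symm hqq'
      · have := e5.1
        rwa [hc] at this
    rintro q ⟨hq, q', hq', hqq', hfq⟩
    -- Both `q` and `ψ q` are double points, hence lie over `u = 0`, and their images have equal
    -- `e`-components because `L` fixes `e`; so `f (ψ q) = f q`.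
    have hfix : T (f q) = f q := by
      rw [← (hW q hq).2.1]
      refine hNself hc _ (hW _ (hψW hq)).2.2.2.1 _ (hW q hq).2.2.2.1 ?_
        (haxis q hq q' hq' hqq' hfq) ?_
      · refine haxis _ (hψW hq) _ (hψW hq') (fun e => hqq' ?_) ?_
        · rw [← hψψW q' hq', e, hψψW q hq]
        · rw [(hW q hq).2.1, (hW q' hq').2.1, hfq]
      · rw [(hW q hq).2.1, hL, add_sub_cancel_left, hfr.inner_map_e]
    refine ⟨hfix, fun hT0 => ?_⟩
    have hε := hfr.ε_eq.resolve_left fun hε => hT0 (hR0 hε)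
    rw [AffineSubspace.mem_mk', htan, Submodule.mem_orthogonal_singleton_iff_inner_left,
      vsub_eq_sub]
    -- The vector is fixed by `L`, while `ε = -1` negates its `t`-component, which is therefore
    -- zero.
    have e1 : L (f q - f p) = f q - f p := by
      rw [hL] at hfix
      exact eq_sub_of_add_eq' hfix
    have e2 := hfr.inner_map_t (f q - f p)
    rw [e1, hε] at e2
    linarith

end Symmetry

end IsFoldChart

end

/-! ### Assembling the two types of singularity -/

theorem mainTheorem5 (r : WithTop ℕ∞) (hr : r = ∞ ∨ r = ω)
    (U : Set (ℝ × ℝ)) (hU : IsOpen U) (f : ℝ × ℝ → E3) (hf : ContDiffOn ℝ r f U)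
    (p : ℝ × ℝ) (hpU : p ∈ U)
    (hp : IsCuspidalEdge r f p ∨ IsCuspidalCrossCap r f p)
    (T : E3 ≃ᵢ E3) (hTp : T (f p) = f p) (hT : T ≠ IsometryEquiv.refl E3)
    (hinv : PreservesImageGerm T f U p) :
    ∃ (W : Set (ℝ × ℝ)) (ψ : ℝ × ℝ → ℝ × ℝ),
      -- the associated local diffeomorphism `ψ`, a `C^r`-involution, unique as a germ
      IsOpen W ∧ IsConnected W ∧ p ∈ W ∧ W ⊆ U ∧ ψ p = p ∧ IsInvolutionOn r ψ W ∧
      (∀ q ∈ W, f (ψ q) = T (f q)) ∧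
      (∀ ψ' : ℝ × ℝ → ℝ × ℝ, (∀ᶠ q in 𝓝 p, ContinuousAt ψ' q) → ψ' p = p →
        (∀ᶠ q in 𝓝 p, f (ψ' q) = T (f q)) → ψ' =ᶠ[𝓝 p] ψ) ∧
      ∀ (ν : ℝ × ℝ → E3) (γ : ℝ → ℝ × ℝ),
        IsUnitNormalNear r f ν p → IsSingularCurve r f U p γ →
        (limitingNormalCurvature f ν γ ≠ 0 → T = reflectionIn (normalPlane f p)) ∧
        (IsCuspidalEdge r f p →
          (T ≠ reflectionIn (conormalLine f ν p) → ReversesOrientationOn ψ W) ∧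
          (T ≠ reflectionIn (limitingTangentPlane f ν p) → ReversesCurve r ψ γ)) ∧
        (IsCuspidalCrossCap r f p →
          (T ≠ reflectionIn (limitingTangentPlane f ν p) →
            T ≠ reflectionIn (conormalLine f ν p) → PreservesOrientationOn ψ W) ∧
          (T ≠ reflectionIn (limitingTangentPlane f ν p) → ReversesCurve r ψ γ) ∧
          ∀ q ∈ selfIntersectionSet f W, T (f q) = f q ∧
            (T ≠ reflectionIn (limitingTangentPlane f ν p) → f q ∈ normalPlane f p)) := by
  have hfp : SmoothNear r f p := hf.smoothNear hU hpU
  have hedge : IsCuspidalEdge r f p → ∃ φ Φ, IsFoldChart r (fun _ => 1) f p φ Φ := fun h => by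
    rw [IsCuspidalEdge, stdCuspidalEdge_eq] at h
    exact h.exists_isFoldChart (.inl rfl) hfp
  have hcross : IsCuspidalCrossCap r f p → ∃ φ Φ, IsFoldChart r id f p φ Φ := fun h => by
    rw [IsCuspidalCrossCap, stdCuspidalCrossCap_eq] at h
    exact h.exists_isFoldChart (.inr rfl) hfp
  -- Local injectivity separates the types, so in each case the assertions about the other type hold
  -- vacuously.
  have hexcl : IsCuspidalEdge r f p → ¬ IsCuspidalCrossCap r f p := fun h1 h2 => by
    obtain ⟨φ, Φ, h3⟩ := hedge h1
    obtain ⟨φ', Φ', h4⟩ := hcross h2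
    obtain ⟨N, hN, hinj⟩ := h3.exists_injOn
    exact h4.not_injOn hN hinj
  rcases hp with hp | hp
  · obtain ⟨φ, Φ, h⟩ := hedge hp
    obtain ⟨W, ψ, h1, h2, h3, h4, h5, h6, h7, h8, h9⟩ := h.exists_involution hr hU hpU hTp hT hinv
    refine ⟨W, ψ, h1, h2, h3, h4, h5, h6, h7, h8, fun ν γ hν hγ => ?_⟩
    obtain ⟨e1, e2, e3, -⟩ := h9 ν γ hν hγ
    exact ⟨e1, fun _ => ⟨e3 rfl, e2⟩, fun hc => absurd hc (hexcl hp)⟩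
  · obtain ⟨φ, Φ, h⟩ := hcross hp
    obtain ⟨W, ψ, h1, h2, h3, h4, h5, h6, h7, h8, h9⟩ := h.exists_involution hr hU hpU hTp hT hinv
    refine ⟨W, ψ, h1, h2, h3, h4, h5, h6, h7, h8, fun ν γ hν hγ => ?_⟩
    obtain ⟨e1, e2, -, e4⟩ := h9 ν γ hν hγ
    exact ⟨e1, fun he => absurd hp (hexcl he), fun _ => ⟨(e4 rfl).1, e2, (e4 rfl).2⟩⟩
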